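/- **Definitions.** Let $I$ be a (possibly infinite) set and $(W,\{s_i\mid i\in I\})$ a Coxeter system with Coxeter matrix $(m_{ij})$. It is *irreducible* if its diagram (with $i\neq j$ joined by an edge if and only if $m_{ij}\neq 2$) is connected and non-empty. A *building* $\Delta$ of type $(W,\{s_i\})$ is a set $C$ of chambers with equivalence relations $\sim_i$ ($i\in I$), each of whose classes has at least two elements, and a map $\delta:C\times C\to W$ such that for every reduced word $f=i_1\cdots i_k$ one has $\delta(x,y)=s_{i_1}\cdots s_{i_k}$ if and only if there are $x=c_0,\dots,c_k=y$ with $c_{j-1}\neq c_j$ and $c_{j-1}\sim_{i_j}c_j$ for all $j$. It is *thick* if every class of every $\sim_i$ has at least three elements, and *irreducible* if its Coxeter system is. For $J\subseteq I$, a *$J$-residue* is a class of the equivalence relation generated by the $\sim_j$, $j\in J$. A *type-preserving automorphism* is a permutation of $C$ that preserves each $\sim_i$. The *diagram geometry* consists of the sets $V_i$ of $(I\setminus\{i\})$-residues, $i\in I$, two residues being incident if they intersect. An action on a set $X$ is *2-transitive* if $|X|\geq 2$ and it is transitive on the ordered pairs of distinct elements of $X$. A *projective space* is a set of points with a collection of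 lines (sets of points), each with at least three points, such that two distinct points lie on exactly one line and the Veblen–Young axiom holds: for distinct points $a,b,c,d$, if the lines $ab$ and $cd$ meet, then the lines $ac$ and $bd$ meet. The *rank* of a subspace is the least number of points that span it ($\infty$ if there is no finite spanning set). **Theorem.** Let $\Delta$ be a thick irreducible building over a (possibly infinite) type set $I$, and let $G$ be a group of type-preserving automorphisms of $\Delta$ which acts 2-transitively on the set of all $J$-residues, for some $J\subseteq I$. Then $\Delta$ is of type $\mathbf A_k$ for some integer $k\geq 1$, or of type $\mathbf A_\omega$. That is, for $\kappa=k$ or $\kappa=\infty$ respectively, the elements of $I$ can be labelled bijectively by the integers $n$ with $1\leq n\leq\kappa$ (by all integers $n\geq 1$ if $\kappa=\infty$) in such a way that $m_{ij}=3$ if the labels of $i$ and $j$ are consecutive integers, and $m_{ij}=2$ for all other $i\neq j$. Moreover, the labelling can be chosen such that, identifying $I$ with the set of labels, the following hold. 1. There is a projective space with point set $V_1$, of rank $\kappa+1$ (so of infinite rank if $\kappa=\infty$), such that for every $n\in I$ the map sending $R\in V_n$ to the set of points incident with $R$ is a bijection from $V_n$ onto the set of subspaces of rank $n$. If $\kappa\geq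 2$, the images of the elements of $V_2$ are precisely the lines. Two elements of the diagram geometry are incident if and only if one of the corresponding subspaces contains the other. 2. $G$ acts 2-transitively on the point set $V_1$ of this projective space. -/

import Mathlib

/-! ### Coxeter diagrams -/

/-- The Coxeter diagram of a Coxeter matrix (without its labels): distinct nodes `i`, `j` are joined
by an edge if and only if `m i j ≠ 2`. The value `∞` is encoded by `0` in `CoxeterMatrix`. -/
def coxeterDiagram {I : Type*} (M : CoxeterMatrix I) : SimpleGraph I where
  Adj i j := i ≠ j ∧ M i j ≠ 2
  symm := ⟨fun i j h => ⟨h.1.symm, by rw [M.symmetric]; exact h.2⟩⟩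
  loopless := ⟨fun _ h => h.1 rfl⟩

/-- The nodes `1, 2, 3, …` of the diagram `A_κ`: the positive integers `n ≤ κ`. For `κ = ⊤` these
are all the positive integers. -/
abbrev ANode (κ : ℕ∞) : Type := {n : ℕ // 1 ≤ n ∧ (n : ℕ∞) ≤ κ}

/-- The Coxeter matrix of type `A_κ`, where `κ = k` is finite (the diagram `1 - 2 - ⋯ - k`) or
`κ = ⊤` (the diagram `A_ω`, that is, `1 - 2 - 3 - ⋯`). -/
def typeA (κ : ℕ∞) : CoxeterMatrix (ANode κ) where
  M := Matrix.of fun i j =>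
    if i = j then 1 else if (i : ℕ) + 1 = j ∨ (j : ℕ) + 1 = i then 3 else 2
  isSymm := by
    ext i j
    simp only [Matrix.transpose_apply, Matrix.of_apply, eq_comm (a := j), or_comm]
  diagonal := by simp
  off_diagonal i j h := by
    simp only [Matrix.of_apply, if_neg h]
    split_ifs <;> decide

/-! ### Chamber systems and buildings -/

/-- A chamber system over `I`: a set `C` of chambers with an equivalence relation (`i`-adjacency)
for every `i : I`. -/
structure ChamberSystem (I C : Type*) where
  adj : I → Setoid C

namespace ChamberSystem

variable {I C : Type*}

/-- `D.IsGallery f x y`: there is a gallery of type `f` from `x` to `y`, i.e. for `f = [i₁, …, iₖ]`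
a sequence `x = c₀, c₁, …, cₖ = y` with `c_{j-1} ≠ c_j` and `c_{j-1} ∼_{i_j} c_j` for all `j`. -/
def IsGallery (D : ChamberSystem I C) : List I → C → C → Prop
  | [], x, y => x = y
  | i :: f, x, y => ∃ z, x ≠ z ∧ D.adj i x z ∧ D.IsGallery f z y

/-- The equivalence relation generated by the relations `∼_j` with `j ∈ J`. -/
def adjJ (D : ChamberSystem I C) (J : Set I) : Setoid C :=
  Relation.EqvGen.setoid fun x y => ∃ j ∈ J, D.adj j x y

/-- The `J`-residues: the equivalence classes of the relation generated by the `∼_j`, `j ∈ J`. -/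
def Residue (D : ChamberSystem I C) (J : Set I) : Type _ := {R : Set C // R ∈ (D.adjJ J).classes}

/-- Every panel (equivalence class of `∼_i`) contains at least three chambers. -/
def IsThick (D : ChamberSystem I C) : Prop :=
  ∀ i x, 3 ≤ {y | D.adj i x y}.encard

/-- The group of type-preserving automorphisms: the permutations of the chambers that preserve each
of the relations `∼_i`. -/
def Aut (D : ChamberSystem I C) : Subgroup (Equiv.Perm C) where
  carrier := {g | ∀ i x y, D.adj i (g x) (g y) ↔ D.adj i x y}
  one_mem' _ _ _ := Iff.rfl
  mul_mem' {a b} ha hb i x y := by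
    simpa only [Equiv.Perm.mul_apply] using (ha i (b x) (b y)).trans (hb i x y)
  inv_mem' {a} ha i x y := by
    have h := ha i (a⁻¹ x) (a⁻¹ y)
    have h' : ∀ z, a (a⁻¹ z) = z := a.apply_symm_apply
    rw [h', h'] at h
    exact h.symm

theorem adjJ_apply (D : ChamberSystem I C) (J : Set I) (g : D.Aut) {x y : C}
    (h : D.adjJ J x y) : D.adjJ J (g.1 x) (g.1 y) := by
  change Relation.EqvGen _ x y at h
  change Relation.EqvGen _ (g.1 x) (g.1 y)
  induction h with
  | rel x y h =>
    obtain ⟨j, hj, hxy⟩ := h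
    exact .rel _ _ ⟨j, hj, (g.2 j x y).2 hxy⟩
  | refl x => exact .refl _
  | symm x y _ ih => exact .symm _ _ ih
  | trans x y z _ _ ih₁ ih₂ => exact .trans _ _ _ ih₁ ih₂

theorem image_mem_classes (D : ChamberSystem I C) (J : Set I) (g : D.Aut) {R : Set C}
    (hR : R ∈ (D.adjJ J).classes) : g.1 '' R ∈ (D.adjJ J).classes := by
  obtain ⟨y, rfl⟩ := hR
  refine ⟨g.1 y, Set.ext fun x => ⟨?_, fun hx => ⟨g.1⁻¹ x, ?_, by simp⟩⟩⟩
  · rintro ⟨z, hz, rfl⟩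
    exact D.adjJ_apply J g hz
  · have h := D.adjJ_apply J g⁻¹ hx
    simpa using h

/-- Type-preserving automorphisms act on the `J`-residues by taking images, `g • R = g '' R`. -/
instance (D : ChamberSystem I C) (J : Set I) : MulAction D.Aut (D.Residue J) where
  smul g R := ⟨g.1 '' R.1, D.image_mem_classes J g R.2⟩
  one_smul R := Subtype.ext (Set.image_id R.1)
  mul_smul g h R := Subtype.ext (Set.image_comp g.1 h.1 R.1)

/-- The elements of type `i` of the diagram geometry: the residues of type `I ∖ {i}`. -/
abbrev Vertex (D : ChamberSystem I C) (i : I) : Type _ := D.Residue {i}ᶜ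

/-- Two elements of the diagram geometry are incident if they share a chamber. -/
def Incident (D : ChamberSystem I C) {i j : I} (R : D.Vertex i) (S : D.Vertex j) : Prop :=
  (R.1 ∩ S.1).Nonempty

/-- The set of elements of type `p` incident with `R`. -/
def shadow (D : ChamberSystem I C) (p : I) {i : I} (R : D.Vertex i) : Set (D.Vertex p) :=
  {x | D.Incident x R}

end ChamberSystem

/-- A building of type `M`: a chamber system over `I` in which every panel has at least two
chambers, together with a `W`-valued distance `δ` such that, for every reduced word `f`, one has
`δ x y = s_f` if and only if `x` and `y` can be joined by a gallery of type `f`. -/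
structure Building {I W : Type*} [Group W] {M : CoxeterMatrix I} (cs : CoxeterSystem M W)
    (C : Type*) extends ChamberSystem I C where
  δ : C → C → W
  exists_ne_adj : ∀ i x, ∃ y, x ≠ y ∧ adj i x y
  δ_eq_iff : ∀ f : List I, cs.IsReduced f → ∀ x y,
    δ x y = cs.wordProd f ↔ toChamberSystem.IsGallery f x y

/-! ### Two-transitive actions -/

/-- A 2-transitive action on a set with at least two elements. -/
def IsTwoTransitive (G X : Type*) [Group G] [MulAction G X] : Prop :=
  Nontrivial X ∧ MulAction.IsMultiplyPretransitive G X 2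

/-! ### Projective spaces -/

/-- A projective space with point set `P`, in the sense of Veblen and Young: two distinct points are
on exactly one line, every line has at least three points, and, for distinct points `a, b, c, d`, if
the line through `a, b` meets the line through `c, d`, then the line through `a, c` meets the line
through `b, d`. -/
structure ProjectiveSpace (P : Type*) where
  lines : Set (Set P)
  existsUnique_line : ∀ a b, a ≠ b → ∃! l, l ∈ lines ∧ a ∈ l ∧ b ∈ l
  three_le_encard : ∀ l ∈ lines, 3 ≤ l.encard
  veblen_young : ∀ a b c d, [a, b, c, d].Nodup → ∀ l ∈ lines, ∀ l' ∈ lines, ∀ m ∈ lines,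
    ∀ m' ∈ lines, a ∈ l → b ∈ l → c ∈ l' → d ∈ l' → a ∈ m → c ∈ m → b ∈ m' → d ∈ m' →
    (l ∩ l').Nonempty → (m ∩ m').Nonempty

namespace ProjectiveSpace

variable {P : Type*}

/-- A subspace: a set of points that contains, with any two of its points, the line through them. -/
def IsSubspace (S : ProjectiveSpace P) (X : Set P) : Prop :=
  ∀ a ∈ X, ∀ b ∈ X, a ≠ b → ∀ l ∈ S.lines, a ∈ l → b ∈ l → l ⊆ X

/-- The subspace spanned by a set of points. -/
def span (S : ProjectiveSpace P) (A : Set P) : Set P :=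
  ⋂₀ {X | S.IsSubspace X ∧ A ⊆ X}

/-- The rank of a subspace `X` (its projective dimension plus one): the least number of points that
span `X`, or `⊤` if `X` is not spanned by finitely many points. -/
noncomputable def rank (S : ProjectiveSpace P) (X : Set P) : ℕ∞ :=
  ⨅ (A : Set P) (_ : S.span A = X), A.encard

end ProjectiveSpace

/-- The diagram geometry of the chamber system `D`, whose types are labelled by `e`, is the geometry
of the projective space `S` of projective dimension `κ`, whose points are the elements of the type
`p` labelled `1`: the elements of the type labelled `n` are, via their shadows, the subspaces of
rank `n`, the lines of `S` being the shadows of the elements of the type labelled `2` if there is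
one, and incidence is symmetrized inclusion. -/
structure IsProjectiveGeometry {I C : Type*} (D : ChamberSystem I C) (κ : ℕ∞) (e : I ≃ ANode κ)
    (p : I) (S : ProjectiveSpace (D.Vertex p)) : Prop where
  label_point : (e p : ℕ) = 1
  rank_univ : S.rank Set.univ = κ + 1
  lines_eq : ∀ i, (e i : ℕ) = 2 →
    S.lines = Set.range (fun R : D.Vertex i => D.shadow p R)
  shadow_injective : ∀ i, Function.Injective (fun R : D.Vertex i => D.shadow p R)
  range_shadow : ∀ i, Set.range (fun R : D.Vertex i => D.shadow p R) =
    {X | S.IsSubspace X ∧ S.rank X = ((e i : ℕ) : ℕ∞)}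
  incident_iff : ∀ i j (R : D.Vertex i) (T : D.Vertex j),
    D.Incident R T ↔ D.shadow p R ⊆ D.shadow p T ∨ D.shadow p T ⊆ D.shadow p R

/-!
The proof first determines the diagram from the Weyl group alone and then builds the projective
space from the Weyl distance.

*The diagram.* Automorphisms preserve the Weyl distance, and every element of `W` is a distance.
Hence 2-transitivity on the `J`-residues forces `W = W_J ∪ W_J s W_J` for every `s ∉ J`, and then
`J = {s}ᶜ`. To see what this says about the diagram, extend the geometric representation of `W` by a
vector `ω` that is fixed by all generators except `s`, where `s ω = ω - α_s`. Since `W_J` fixes `ω`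
and does not change coefficients at `α_s`, the coefficient of `α_s` in `ω - w ω` depends only on the
double coset of `w`, so it is `0` or `1` for every `w`
(`Building.weightRep_weight_some_of_isTwoTransitive`). If `g` is the product of the generators along
a simply laced path from `s` to a node `v`, this coefficient for `g⁻¹ t g` is `4 cos² (π / m)`,
where `t` is a further neighbour of `v` and `m = m_tv`; so `m = 3`. With two further neighbours
`t, u`, it is at least `2` for `g⁻¹ u t g`, so there is at most one.
Hence the diagram is a path starting
at `s`, and the nodes can be labelled by their distance from `s`, increased by one
(`CoxeterSystem.exists_typeALabelling`).

*The projective space.* In type `A`, let `W` act on `ℕ` so that the generator with label `n`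
interchanges `n` and `n + 1`. A generator is a right descent of `w` exactly where `w` inverts two
consecutive numbers (`TypeALabelling.isRightDescent_iff_perm_lt`), so two chambers have the same
element of type `n` if and only if their distance preserves `{1, …, n}` (`Building.agree_iff`). The
position of a point `x` with respect to a chamber `c` is the image of `1` under the distance from
`c` to any chamber in `x`; the flat of rank `n` of `c` consists of the points at position at most
`n`. Two facts carry the geometry: positions transform under a change of the chamber as long as the
distance is increasing there (`Building.pos_eq_perm`), and a flag can be moved below the position of
a point to reach that point earlier (`Building.exists_agree_pos_eq`). They yield the uniqueness of
lines, that lines of a flat of rank `n + 1` meet its flats of rank `n`, hence the Veblen–Young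
axiom, and that the spans of finitely many points are exactly the flats. Finally, an inclusion of
flats is always realized in the flag of one chamber, as one sees from two chambers at minimal
distance (`Building.exists_agree_of_flat_subset`); this gives the ranks and the description of
incidence.

The 2-transitivity on points is the hypothesis itself, since `J = {s}ᶜ` and `s` is the node with
label `1`.
-/

/-! ### Galleries and the Weyl distance -/

namespace ChamberSystem

variable {I C : Type*} (D : ChamberSystem I C)

theorem isGallery_append {f g : List I} {x z : C} :
    D.IsGallery (f ++ g) x z ↔ ∃ y, D.IsGallery f x y ∧ D.IsGallery g y z := by
  induction f generalizing x with
  | nil => simp [IsGallery]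
  | cons i f ih =>
    simp only [List.cons_append, IsGallery, ih]
    constructor
    · rintro ⟨u, h₁, h₂, y, h₃, h₄⟩
      exact ⟨y, ⟨u, h₁, h₂, h₃⟩, h₄⟩
    · rintro ⟨y, ⟨u, h₁, h₂, h₃⟩, h₄⟩
      exact ⟨u, h₁, h₂, y, h₃, h₄⟩

theorem isGallery_singleton {i : I} {x y : C} : D.IsGallery [i] x y ↔ x ≠ y ∧ D.adj i x y := by
  simp only [IsGallery]
  constructor
  · rintro ⟨z, h, h', rfl⟩
    exact ⟨h, h'⟩
  · rintro ⟨h, h'⟩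
    exact ⟨y, h, h', rfl⟩

theorem IsGallery.reverse {D : ChamberSystem I C} {f : List I} {x y : C} (h : D.IsGallery f x y) :
    D.IsGallery f.reverse y x := by
  induction f generalizing x with
  | nil => exact Eq.symm h
  | cons i f ih =>
    obtain ⟨z, hne, hadj, hz⟩ := h
    rw [List.reverse_cons, isGallery_append]
    exact ⟨z, ih hz, (D.isGallery_singleton).2 ⟨hne.symm, (D.adj i).symm hadj⟩⟩

theorem IsGallery.map {D : ChamberSystem I C} (g : D.Aut) {f : List I} {x y : C}
    (h : D.IsGallery f x y) : D.IsGallery f (g.1 x) (g.1 y) := by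
  induction f generalizing x with
  | nil => exact congrArg g.1 h
  | cons i f ih =>
    obtain ⟨z, hne, hadj, hz⟩ := h
    exact ⟨g.1 z, g.1.injective.ne hne, (g.2 i x z).2 hadj, ih hz⟩

/-- The residue containing a given chamber. -/
def residueOf (J : Set I) (c : C) : D.Residue J :=
  ⟨{x | D.adjJ J x c}, (D.adjJ J).mem_classes c⟩

theorem mem_residueOf (J : Set I) (c : C) : c ∈ (D.residueOf J c).1 := (D.adjJ J).refl c

theorem adjJ_of_mem {J : Set I} {R : D.Residue J} {c d : C} (hc : c ∈ R.1) (hd : d ∈ R.1) :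
    D.adjJ J c d := by
  obtain ⟨R, y, rfl⟩ := R
  exact (D.adjJ J).trans hc ((D.adjJ J).symm hd)

theorem mem_of_adjJ {J : Set I} {R : D.Residue J} {c d : C} (hc : c ∈ R.1)
    (h : D.adjJ J c d) : d ∈ R.1 := by
  obtain ⟨R, y, rfl⟩ := R
  exact (D.adjJ J).trans ((D.adjJ J).symm h) hc

theorem residue_nonempty {J : Set I} (R : D.Residue J) : R.1.Nonempty := by
  obtain ⟨R, y, rfl⟩ := R
  exact ⟨y, (D.adjJ J).refl y⟩

theorem residue_eq {J : Set I} {R S : D.Residue J} {c : C} (hR : c ∈ R.1) (hS : c ∈ S.1) :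
    R = S :=
  Subtype.ext <| Set.ext fun _ =>
    ⟨fun h => D.mem_of_adjJ hS (D.adjJ_of_mem hR h), fun h => D.mem_of_adjJ hR (D.adjJ_of_mem hS h)⟩

theorem adjJ_of_adj {J : Set I} {i : I} (hi : i ∈ J) {c d : C} (h : D.adj i c d) :
    D.adjJ J c d := .rel _ _ ⟨i, hi, h⟩

end ChamberSystem

namespace Building

variable {I W C : Type*} [Group W] {M : CoxeterMatrix I} {cs : CoxeterSystem M W}
  (Δ : Building cs C)

theorem δ_eq_one_iff {x y : C} : Δ.δ x y = 1 ↔ x = y := by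
  have h := Δ.δ_eq_iff [] (by simp [CoxeterSystem.IsReduced]) x y
  rwa [cs.wordProd_nil] at h

@[simp] theorem δ_self (x : C) : Δ.δ x x = 1 := Δ.δ_eq_one_iff.2 rfl

theorem δ_symm (x y : C) : Δ.δ y x = (Δ.δ x y)⁻¹ := by
  obtain ⟨f, hf, h⟩ := cs.exists_isReduced (Δ.δ x y)
  rw [h, ← cs.wordProd_reverse, Δ.δ_eq_iff _ hf.reverse]
  exact ((Δ.δ_eq_iff f hf x y).1 h).reverse

theorem δ_map (g : Δ.Aut) (x y : C) : Δ.δ (g.1 x) (g.1 y) = Δ.δ x y := by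
  obtain ⟨f, hf, h⟩ := cs.exists_isReduced (Δ.δ x y)
  rw [h, Δ.δ_eq_iff f hf]
  exact ((Δ.δ_eq_iff f hf x y).1 h).map g

theorem δ_of_adj {i : I} {y z : C} (hne : y ≠ z) (h : Δ.adj i y z) : Δ.δ y z = cs.simple i := by
  rw [← cs.wordProd_singleton, Δ.δ_eq_iff _ (by simp [CoxeterSystem.IsReduced])]
  exact Δ.isGallery_singleton.2 ⟨hne, h⟩

/-- A word for an element that does not have `i` as a right descent can be extended by `i`. -/
theorem isReduced_append_singleton {f : List I} (hf : cs.IsReduced f) {i : I}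
    (hi : ¬ cs.IsRightDescent (cs.wordProd f) i) : cs.IsReduced (f ++ [i]) := by
  rw [cs.not_isRightDescent_iff] at hi
  rw [CoxeterSystem.IsReduced, cs.wordProd_append, cs.wordProd_singleton, hi, hf.eq]
  simp

theorem δ_of_adj_of_not_descent {i : I} (x : C) {y z : C} (hne : y ≠ z) (h : Δ.adj i y z)
    (hi : ¬ cs.IsRightDescent (Δ.δ x y) i) : Δ.δ x z = Δ.δ x y * cs.simple i := by
  obtain ⟨f, hf, hw⟩ := cs.exists_isReduced (Δ.δ x y)
  have hg := (Δ.δ_eq_iff f hf x y).1 hw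
  rw [hw] at hi ⊢
  rw [← cs.wordProd_singleton, ← cs.wordProd_append,
    Δ.δ_eq_iff _ (isReduced_append_singleton hf hi)]
  exact Δ.isGallery_append.2 ⟨y, hg, Δ.isGallery_singleton.2 ⟨hne, h⟩⟩

/-- If `i` is a right descent of the distance from `x` to `y`, then the `i`-panel of `y` contains a
chamber that is closer to `x`. -/
theorem exists_adj_of_descent {i : I} (x y : C) (hi : cs.IsRightDescent (Δ.δ x y) i) :
    ∃ z, z ≠ y ∧ Δ.adj i z y ∧ Δ.δ x z = Δ.δ x y * cs.simple i := by
  obtain ⟨f, hf, hw⟩ := cs.exists_isReduced (Δ.δ x y * cs.simple i)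
  have hi' := cs.isRightDescent_iff_not_isRightDescent_mul.1 hi
  rw [hw] at hi'
  have hr := isReduced_append_singleton hf hi'
  have hw' : Δ.δ x y = cs.wordProd (f ++ [i]) := by
    rw [cs.wordProd_append, cs.wordProd_singleton, ← hw, cs.simple_mul_simple_cancel_right]
  obtain ⟨z, hz, hzy⟩ := Δ.isGallery_append.1 ((Δ.δ_eq_iff _ hr x y).1 hw')
  obtain ⟨hne, hadj⟩ := Δ.isGallery_singleton.1 hzy
  exact ⟨z, hne, hadj, by rw [hw, Δ.δ_eq_iff f hf]; exact hz⟩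

theorem exists_adj_δ_eq (i : I) (x y : C) :
    ∃ z, Δ.adj i y z ∧ Δ.δ x z = Δ.δ x y * cs.simple i := by
  by_cases hi : cs.IsRightDescent (Δ.δ x y) i
  · obtain ⟨z, -, h, h'⟩ := Δ.exists_adj_of_descent x y hi
    exact ⟨z, (Δ.adj i).symm h, h'⟩
  · obtain ⟨z, hne, h⟩ := Δ.exists_ne_adj i y
    exact ⟨z, h, Δ.δ_of_adj_of_not_descent x hne h hi⟩

theorem δ_of_adj_or {i : I} (x : C) {y z : C} (h : Δ.adj i y z) :
    Δ.δ x z = Δ.δ x y ∨ Δ.δ x z = Δ.δ x y * cs.simple i := by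
  by_cases hyz : y = z
  · exact .inl (hyz ▸ rfl)
  by_cases hi : cs.IsRightDescent (Δ.δ x y) i
  · obtain ⟨u, hne, hadj, hu⟩ := Δ.exists_adj_of_descent x y hi
    by_cases huz : u = z
    · exact .inr (huz ▸ hu)
    · left
      rw [Δ.δ_of_adj_of_not_descent x huz ((Δ.adj i).trans hadj h), hu,
        cs.simple_mul_simple_cancel_right]
      rw [hu]
      exact cs.isRightDescent_iff_not_isRightDescent_mul.1 hi
  · exact .inr (Δ.δ_of_adj_of_not_descent x hyz h hi)

theorem exists_δ_eq (x : C) (w : W) : ∃ y, Δ.δ x y = w := by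
  induction w using cs.simple_induction_right with
  | one => exact ⟨x, Δ.δ_self x⟩
  | mul_simple_right w i ih =>
    obtain ⟨y, rfl⟩ := ih
    obtain ⟨z, -, hz⟩ := Δ.exists_adj_δ_eq i x y
    exact ⟨z, hz⟩

theorem inv_mul_δ_mem_of_adjJ {J : Set I} {P : Subgroup W} (hP : ∀ j ∈ J, cs.simple j ∈ P) (x : C)
    {y z : C} (h : Δ.adjJ J y z) : (Δ.δ x y)⁻¹ * Δ.δ x z ∈ P := by
  change Relation.EqvGen _ y z at h
  induction h with
  | rel y z h =>
    obtain ⟨j, hj, h⟩ := h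
    rcases Δ.δ_of_adj_or x h with h | h <;> rw [h]
    · simp
    · simpa using hP j hj
  | refl y => simp
  | symm y z _ ih => simpa using P.inv_mem ih
  | trans y z u _ _ ih₁ ih₂ => simpa [mul_assoc] using P.mul_mem ih₁ ih₂

theorem δ_mem_of_adjJ {J : Set I} {P : Subgroup W} (hP : ∀ j ∈ J, cs.simple j ∈ P)
    {y z : C} (h : Δ.adjJ J y z) : Δ.δ y z ∈ P := by
  simpa using Δ.inv_mul_δ_mem_of_adjJ hP y h

theorem adjJ_univ (x y : C) : Δ.adjJ Set.univ x y := by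
  obtain ⟨f, hf, h⟩ := cs.exists_isReduced (Δ.δ x y)
  have hg := (Δ.δ_eq_iff f hf x y).1 h
  clear hf h
  induction f generalizing x with
  | nil => exact hg ▸ (Δ.adjJ _).refl _
  | cons i f ih =>
    obtain ⟨z, -, hadj, hz⟩ := hg
    exact (Δ.adjJ _).trans (Δ.adjJ_of_adj (Set.mem_univ i) hadj) (ih z hz)

end Building

/-! ### Orders of products of two reflections -/

/-- The product of two reflections `r₁, r₂` in vectors `x, y` with `f y = g x = -2 cos (π / m)` has
order dividing `m`: it is a rotation by the angle `2π / m`. For `m = 0` there is nothing to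
prove. -/
theorem Module.reflection_mul_reflection_pow_eq_one {V : Type*} [AddCommGroup V] [Module ℝ V]
    {x y : V} {f g : Module.Dual ℝ V} (hf : f x = 2) (hg : g y = 2) (m : ℕ) (hm : m ≠ 1)
    (hfy : f y = -2 * Real.cos (Real.pi / m)) (hgx : g x = -2 * Real.cos (Real.pi / m)) :
    (Module.reflection hf * Module.reflection hg) ^ m = 1 := by
  rcases Nat.lt_or_ge m 3 with h | h
  · interval_cases m
    · simp
    · exact absurd rfl hm
    · have hfy : f y = 0 := by simpa using hfy
      have hgx : g x = 0 := by simpa using hgx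
      ext z
      simp only [pow_two, LinearEquiv.mul_apply, Module.reflection_apply, map_sub, map_smul, hf, hg,
        hfy, hgx, LinearEquiv.coe_one, id]
      module
  · have hm0 : (0 : ℝ) < m := by positivity
    have hm3 : (3 : ℝ) ≤ m := by exact_mod_cast h
    set θ : ℝ := 2 * Real.pi / m with hθ
    have hθm : m * θ = 2 * Real.pi := by rw [hθ]; field_simp
    have ht : 2 * Real.cos θ = f y * g x - 2 := by
      rw [hfy, hgx, hθ, mul_div_assoc, Real.cos_two_mul]
      ring
    have hsin : Real.sin θ ≠ 0 := by
      refine (Real.sin_pos_of_pos_of_lt_pi (by positivity) ?_).ne'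
      rw [hθ, div_lt_iff₀ hm0]
      nlinarith [Real.pi_pos]
    have hS (n : ℤ) : (Polynomial.Chebyshev.S ℝ n).eval (2 * Real.cos θ) * Real.sin θ =
      Real.sin ((n + 1) * θ) := Polynomial.Chebyshev.S_two_mul_real_cos θ n
    ext z
    rw [Module.reflection_mul_reflection_pow_apply hf hg m z (2 * Real.cos θ) ht]
    -- For even `m` both coefficients contain `S (m / 2 - 1) = 0`, for odd `m` they contain the sum
    -- of two consecutive values of `S` at which the sines cancel.
    obtain ⟨k, rfl | rfl⟩ := Nat.even_or_odd' m
    · have h₁ : (((2 * k : ℕ) : ℤ) - 2) / 2 = k - 1 := by lia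
      have h₂ : (((2 * k : ℕ) : ℤ) - 1) / 2 = k - 1 := by lia
      have h0 : (Polynomial.Chebyshev.S ℝ (k - 1)).eval (2 * Real.cos θ) = 0 := by
        have := hS (k - 1)
        push_cast at this hθm
        rw [sub_add_cancel, show (k : ℝ) * θ = Real.pi by linarith, Real.sin_pi] at this
        exact (mul_eq_zero.1 this).resolve_right hsin
      rw [h₁, h₂, h0]
      simp
    · have h₁ : (((2 * k + 1 : ℕ) : ℤ) - 2) / 2 = k - 1 := by lia
      have h₂ : (((2 * k + 1 : ℕ) : ℤ) - 1) / 2 = k := by lia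
      have h₃ : (((2 * k + 1 : ℕ) : ℤ) - 3) / 2 = k - 1 := by lia
      have h₄ : ((2 * k + 1 : ℕ) : ℤ) / 2 = k := by lia
      have h0 : (Polynomial.Chebyshev.S ℝ k).eval (2 * Real.cos θ) +
          (Polynomial.Chebyshev.S ℝ (k - 1)).eval (2 * Real.cos θ) = 0 := by
        have e₁ := hS k
        have e₂ := hS (k - 1)
        push_cast at e₁ e₂ hθm
        rw [show ((k : ℝ) + 1) * θ = 2 * Real.pi - k * θ by linarith, Real.sin_two_pi_sub] at e₁
        rw [sub_add_cancel] at e₂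
        refine (mul_eq_zero.1 (?_ : _ * Real.sin θ = 0)).resolve_right hsin
        linarith
      rw [h₁, h₂, h₃, h₄, h0]
      simp

/-! ### The reflection representation extended by a fundamental weight -/

namespace CoxeterMatrix

variable {I : Type*} (M : CoxeterMatrix I)

/-- The space with a basis consisting of the simple roots `α i` and of one further vector `ω`. -/
abbrev RootSpace (I : Type*) : Type _ := Option I →₀ ℝ

/-- The simple root `α i`. -/
noncomputable abbrev root (i : I) : RootSpace I := Finsupp.single (some i) 1

/-- The extra basis vector `ω`, on which only the reflection `s` acts non-trivially. -/
noncomputable abbrev weight (I : Type*) : RootSpace I := Finsupp.single none 1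

open scoped Classical in
/-- The simple coroot of `i`: it takes the value `-2 cos (π / m i j)` at `α j`, which is `-2` if
`m i j = ∞` because this is encoded by `0` and `π / 0 = 0`, and at `ω` it is `1` if `i = s` and `0`
otherwise. -/
noncomputable def coroot (s i : I) : Module.Dual ℝ (RootSpace I) :=
  Finsupp.linearCombination ℝ fun o : Option I =>
    o.elim (if i = s then 1 else 0) fun j => -2 * Real.cos (Real.pi / M i j)

theorem coroot_root (s i j : I) : M.coroot s i (root j) = -2 * Real.cos (Real.pi / M i j) := by
  simp [coroot]

theorem coroot_self (s i : I) : M.coroot s i (root i) = 2 := by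
  simp [coroot_root]

theorem coroot_weight_self (s : I) : M.coroot s s (weight I) = 1 := by
  simp [coroot]

theorem coroot_weight_of_ne {s i : I} (h : i ≠ s) : M.coroot s i (weight I) = 0 := by
  simp [coroot, h]

theorem coroot_root_comm (s i j : I) : M.coroot s i (root j) = M.coroot s j (root i) := by
  rw [coroot_root, coroot_root, M.symmetric]

/-- Joined nodes of the diagram have roots with product at most `-1`. -/
theorem coroot_root_le {s i j : I} (h : (coxeterDiagram M).Adj i j) :
    M.coroot s i (root j) ≤ -1 := by
  obtain ⟨hne, h2⟩ := h
  rw [coroot_root]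
  have h1 := M.off_diagonal i j hne
  have : (1 : ℝ) / 2 ≤ Real.cos (Real.pi / M i j) := by
    rcases Nat.eq_zero_or_pos (M i j) with h0 | h0
    · rw [h0]
      norm_num
    · have h3 : (3 : ℝ) ≤ M i j := by
        have : 3 ≤ M i j := by lia
        exact_mod_cast this
      rw [← Real.cos_pi_div_three]
      apply Real.cos_le_cos_of_nonneg_of_le_pi (by positivity)
      · linarith [Real.pi_pos]
      · exact div_le_div_of_nonneg_left Real.pi_pos.le (by norm_num) h3
  linarith

theorem coroot_root_of_not_adj {s i j : I} (hne : i ≠ j) (h : ¬ (coxeterDiagram M).Adj i j) :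
    M.coroot s i (root j) = 0 := by
  have : M i j = 2 := by
    by_contra h2
    exact h ⟨hne, h2⟩
  rw [coroot_root, this]
  simp

theorem eq_three_of_coroot_root {s i j : I} (h : M.coroot s i (root j) = -1) : M i j = 3 := by
  have hcos : Real.cos (Real.pi / M i j) = Real.cos (Real.pi / 3) := by
    rw [coroot_root] at h
    rw [Real.cos_pi_div_three]
    linarith
  have hpos : 0 < M i j := by
    rcases Nat.eq_zero_or_pos (M i j) with h0 | h0
    · rw [h0, Real.cos_pi_div_three] at hcos
      norm_num at hcos
    · exact h0
  have hge : (1 : ℝ) ≤ M i j := by exact_mod_cast hpos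
  have := Real.injOn_cos ⟨by positivity, div_le_self Real.pi_pos.le hge⟩
    ⟨by positivity, by linarith [Real.pi_pos]⟩ hcos
  have h3 : (M i j : ℝ) = 3 := by
    have hpi := Real.pi_pos.ne'
    field_simp at this
    linarith
  exact_mod_cast h3

theorem isLiftable_reflection (s : I) :
    M.IsLiftable fun i => Module.reflection (M.coroot_self s i) := by
  intro i j
  by_cases h : i = j
  · subst h
    rw [M.diagonal, pow_one]
    exact inv_mul_cancel (Module.reflection (M.coroot_self s i))
  · refine Module.reflection_mul_reflection_pow_eq_one _ _ _ (M.off_diagonal i j h)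
      (M.coroot_root s i j) ?_
    rw [M.coroot_root_comm, M.coroot_root]

end CoxeterMatrix

namespace CoxeterSystem

open CoxeterMatrix

variable {I W : Type*} [Group W] {M : CoxeterMatrix I} (cs : CoxeterSystem M W)

/-- The representation of `W` in which the simple generators act as reflections in the simple
roots. It extends the geometric representation by a vector `ω` that is moved only by `s`. -/
noncomputable def weightRep (s : I) : W →* (RootSpace I ≃ₗ[ℝ] RootSpace I) :=
  cs.lift ⟨_, M.isLiftable_reflection s⟩

theorem weightRep_simple (s i : I) (v : RootSpace I) :
    cs.weightRep s (cs.simple i) v = v - M.coroot s i v • root i := by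
  rw [weightRep, cs.lift_apply_simple (M.isLiftable_reflection s), Module.reflection_apply]

/-- The standard parabolic subgroup `W_J`. -/
def parabolic (J : Set I) : Subgroup W := Subgroup.closure (cs.simple '' J)

theorem simple_mem_parabolic {J : Set I} {j : I} (hj : j ∈ J) : cs.simple j ∈ cs.parabolic J :=
  Subgroup.subset_closure ⟨j, hj, rfl⟩

theorem weightRep_weight {s : I} {w : W} (hw : w ∈ cs.parabolic {s}ᶜ) :
    cs.weightRep s w (weight I) = weight I := by
  let P : Subgroup W := (MulAction.stabilizer (RootSpace I ≃ₗ[ℝ] RootSpace I) (weight I)).comap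
    (cs.weightRep s)
  suffices h : cs.parabolic {s}ᶜ ≤ P from h hw
  refine (Subgroup.closure_le _).2 ?_
  rintro _ ⟨j, hj, rfl⟩
  change cs.weightRep s (cs.simple j) (weight I) = weight I
  rw [weightRep_simple, coroot_weight_of_ne M hj, zero_smul, sub_zero]

/-- The action of `W_J` does not change the coefficient of a simple root outside `J`. -/
theorem weightRep_apply_some {s : I} {w : W} (hw : w ∈ cs.parabolic {s}ᶜ) (v : RootSpace I) :
    cs.weightRep s w v (some s) = v (some s) := by
  induction hw using Subgroup.closure_induction generalizing v with
  | mem w h =>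
    obtain ⟨j, hj, rfl⟩ := h
    have hj : j ≠ s := hj
    simp [weightRep_simple, hj]
  | one => simp
  | mul x y _ _ ihx ihy => rw [map_mul, LinearEquiv.mul_apply, ihx, ihy]
  | inv x _ ih =>
    rw [← ih, ← LinearEquiv.mul_apply, ← map_mul, mul_inv_cancel, map_one]
    rfl

theorem parabolic_mono {J K : Set I} (h : J ⊆ K) : cs.parabolic J ≤ cs.parabolic K :=
  Subgroup.closure_mono (Set.image_mono h)

theorem simple_notMem_parabolic (s : I) : cs.simple s ∉ cs.parabolic {s}ᶜ := by
  intro h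
  have := cs.weightRep_weight h
  rw [weightRep_simple, coroot_weight_self] at this
  have := DFunLike.congr_fun this (some s)
  simp at this

end CoxeterSystem

/-! ### Two double cosets -/

namespace Building

open CoxeterMatrix

variable {I W C : Type*} [Group W] {M : CoxeterMatrix I} {cs : CoxeterSystem M W}
  (Δ : Building cs C)

/-- If the group is 2-transitive on the `J`-residues, then `W` is the union of the double cosets
`W_J` and `W_J s W_J`, for every `s` outside `J`. -/
theorem exists_mul_mul_of_isTwoTransitive {G : Subgroup Δ.Aut} {J : Set I}
    (hG : IsTwoTransitive G (Δ.Residue J)) {s : I} (hs : s ∉ J) {w : W}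
    (hw : w ∉ cs.parabolic J) :
    ∃ u ∈ cs.parabolic J, ∃ v ∈ cs.parabolic J, w = u * cs.simple s * v := by
  have hJ : ∀ j ∈ J, cs.simple j ∈ cs.parabolic J := fun j hj => cs.simple_mem_parabolic hj
  obtain ⟨⟨R, -, -⟩, h2⟩ := hG
  obtain ⟨x, -⟩ := Δ.residue_nonempty R
  obtain ⟨y, hy⟩ := Δ.exists_δ_eq x (cs.simple s)
  obtain ⟨z, hz⟩ := Δ.exists_δ_eq x w
  have hne {c : C} (h : Δ.δ x c ∉ cs.parabolic J) : Δ.residueOf J x ≠ Δ.residueOf J c := by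
    intro h'
    refine h (Δ.δ_mem_of_adjJ hJ (Δ.adjJ_of_mem (Δ.mem_residueOf J x) ?_))
    rw [h']
    exact Δ.mem_residueOf J c
  have hy' : Δ.δ x y ∉ cs.parabolic J := by
    rw [hy]
    exact fun h => cs.simple_notMem_parabolic s
      (cs.parabolic_mono (fun j hj (hjs : j = s) => hs (hjs ▸ hj)) h)
  obtain ⟨g, hgx, hgy⟩ := MulAction.is_two_pretransitive_iff.1 h2 (hne hy') (hne (hz ▸ hw))
  have hgx' : g.1.1 x ∈ (Δ.residueOf J x).1 := by
    rw [← hgx]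
    exact ⟨x, Δ.mem_residueOf J x, rfl⟩
  have hgy' : g.1.1 y ∈ (Δ.residueOf J z).1 := by
    rw [← hgy]
    exact ⟨y, Δ.mem_residueOf J y, rfl⟩
  have h₁ := Δ.inv_mul_δ_mem_of_adjJ hJ (g.1.1 y) (Δ.adjJ_of_mem hgx' (Δ.mem_residueOf J x))
  have h₂ := Δ.inv_mul_δ_mem_of_adjJ hJ x (Δ.adjJ_of_mem hgy' (Δ.mem_residueOf J z))
  rw [Δ.δ_symm (g.1.1 x), Δ.δ_map g.1, hy, cs.inv_simple, cs.inv_simple] at h₁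
  rw [hz] at h₂
  refine ⟨_, (cs.parabolic J).inv_mem h₁, _, h₂, ?_⟩
  rw [Δ.δ_symm x (g.1.1 y)]
  simp

theorem eq_compl_singleton_of_isTwoTransitive {G : Subgroup Δ.Aut} {J : Set I}
    (hG : IsTwoTransitive G (Δ.Residue J)) : ∃ s, J = {s}ᶜ := by
  obtain ⟨s, hs⟩ : ∃ s, s ∉ J := by
    by_contra! h
    obtain ⟨R, S, hRS⟩ := hG.1
    obtain ⟨x, hx⟩ := Δ.residue_nonempty R
    obtain ⟨y, hy⟩ := Δ.residue_nonempty S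
    refine hRS (Δ.residue_eq (Δ.mem_of_adjJ hx ?_) hy)
    rw [Set.eq_univ_of_forall h]
    exact Δ.adjJ_univ x y
  refine ⟨s, Set.Subset.antisymm (fun j hj (hjs : j = s) => hs (hjs ▸ hj)) fun t hts => ?_⟩
  by_contra ht
  have hJt : cs.parabolic J ≤ cs.parabolic {t}ᶜ :=
    cs.parabolic_mono fun j hj (hjs : j = t) => ht (hjs ▸ hj)
  -- Otherwise `t` would be a product of generators other than `t`.
  obtain ⟨u, hu, v, hv, h⟩ := Δ.exists_mul_mul_of_isTwoTransitive hG hs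
    (fun h => cs.simple_notMem_parabolic t (hJt h))
  apply cs.simple_notMem_parabolic t
  rw [h]
  exact mul_mem (mul_mem (hJt hu) (cs.simple_mem_parabolic fun h : s = t => hts h.symm)) (hJt hv)

/-- In terms of the weight `ω` that belongs to `s`, the vector `ω - w ω` has `α s`-coefficient
`0` or `1`, according to the double coset of `w`. -/
theorem weightRep_weight_some_of_isTwoTransitive {G : Subgroup Δ.Aut} {s : I}
    (hG : IsTwoTransitive G (Δ.Residue {s}ᶜ)) (w : W) :
    cs.weightRep s w (weight I) (some s) = 0 ∨ cs.weightRep s w (weight I) (some s) = -1 := by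
  by_cases hw : w ∈ cs.parabolic {s}ᶜ
  · left
    rw [cs.weightRep_weight hw]
    simp
  · right
    obtain ⟨u, hu, v, hv, rfl⟩ := Δ.exists_mul_mul_of_isTwoTransitive hG (s := s) (by simp) hw
    rw [map_mul, map_mul, LinearEquiv.mul_apply, LinearEquiv.mul_apply, cs.weightRep_weight hv,
      cs.weightRep_apply_some hu, cs.weightRep_simple, coroot_weight_self]
    simp

end Building

/-! ### Classification of the diagram -/

namespace SimpleGraph

theorem Connected.exists_adj_dist_eq {V : Type*} {Γ : SimpleGraph V} (h : Γ.Connected) {s v : V}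
    {n : ℕ} (hn : Γ.dist s v = n + 1) : ∃ u, Γ.Adj u v ∧ Γ.dist s u = n := by
  obtain ⟨p, hp⟩ := h.exists_walk_length_eq_dist v s
  rw [dist_comm, hn] at hp
  cases p with
  | nil => simp at hp
  | cons hadj p =>
    rename_i u
    refine ⟨u, hadj.symm, ?_⟩
    rw [Walk.length_cons] at hp
    have h₁ := dist_le p
    have h₂ := h.dist_triangle (u := s) (v := u) (w := v)
    rw [dist_comm] at h₁
    rw [dist_eq_one_iff_adj.2 hadj.symm] at h₂
    lia

end SimpleGraph

/-- An identification of a Coxeter matrix with the one of type `A_κ`, in the form of a labelling of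
its nodes by natural numbers that is a bijection onto the set of all `n` with `1 ≤ n ≤ κ`. -/
structure TypeALabelling {I : Type*} (M : CoxeterMatrix I) (κ : ℕ∞) where
  label : I → ℕ
  label_injective : Function.Injective label
  one_le_label : ∀ i, 1 ≤ label i
  label_le : ∀ i, (label i : ℕ∞) ≤ κ
  exists_label : ∀ n : ℕ, 1 ≤ n → (n : ℕ∞) ≤ κ → ∃ i, label i = n
  eq_three : ∀ i j, label i + 1 = label j → M i j = 3
  eq_two : ∀ i j, label i + 1 < label j → M i j = 2

namespace TypeALabelling

variable {I : Type*} {M : CoxeterMatrix I} {κ : ℕ∞} (L : TypeALabelling M κ)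

/-- The bijection onto the nodes of `A_κ`. -/
noncomputable def equiv : I ≃ ANode κ :=
  Equiv.ofBijective (fun i => ⟨L.label i, L.one_le_label i, L.label_le i⟩)
    ⟨fun _ _ h => L.label_injective (congrArg Subtype.val h), fun ⟨n, h, h'⟩ =>
      (L.exists_label n h h').imp fun _ hi => Subtype.ext hi⟩

theorem coe_equiv (i : I) : (L.equiv i : ℕ) = L.label i := rfl

theorem reindex_equiv : M.reindex L.equiv = typeA κ := by
  ext a b
  obtain ⟨i, rfl⟩ := L.equiv.surjective a
  obtain ⟨j, rfl⟩ := L.equiv.surjective b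
  rw [CoxeterMatrix.reindex_apply, Equiv.symm_apply_apply, Equiv.symm_apply_apply]
  change M i j = if L.equiv i = L.equiv j then 1 else
    if (L.equiv i : ℕ) + 1 = L.equiv j ∨ (L.equiv j : ℕ) + 1 = L.equiv i then 3 else 2
  by_cases h₁ : i = j
  · rw [h₁, if_pos rfl]
    exact M.diagonal j
  rw [if_neg (L.equiv.injective.ne h₁), L.coe_equiv, L.coe_equiv]
  split_ifs with h₂
  · rcases h₂ with h | h
    · exact L.eq_three i j h
    · exact (M.symmetric i j).trans (L.eq_three j i h)
  · have := L.label_injective.ne h₁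
    rcases Nat.lt_or_ge (L.label i) (L.label j) with h | h
    · exact L.eq_two i j (by lia)
    · exact (M.symmetric i j).trans (L.eq_two j i (by lia))

end TypeALabelling

namespace CoxeterSystem

open CoxeterMatrix

variable {I W : Type*} [Group W] {M : CoxeterMatrix I} (cs : CoxeterSystem M W)

/-- For a node `v` at distance `n` from `s`, the element `g` is meant to be the product
`s_v ⋯ s_s` along a path of simply laced edges from `s` to `v`. It maps `ω` to `ω` minus the sum of
the simple roots on this path. The two conditions say that nodes `t` further away see only `v` in
this sum, and that `g⁻¹ (α t)` has the coefficient at `α s` that belongs to this path. -/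
def IsPathElement (s v : I) (g : W) : Prop :=
  ∀ t, (coxeterDiagram M).dist s v < (coxeterDiagram M).dist s t →
    M.coroot s t (cs.weightRep s g (weight I)) = -M.coroot s t (root v) ∧
    cs.weightRep s g⁻¹ (root t) (some s) = -M.coroot s t (root v)

variable {cs}

theorem weightRep_inv_apply (s : I) (g : W) (v : RootSpace I) :
    cs.weightRep s g⁻¹ (cs.weightRep s g v) = v := by
  rw [← LinearEquiv.mul_apply, ← map_mul, inv_mul_cancel, map_one]
  rfl

theorem IsPathElement.eq_three {s v : I} {g : W} (hg : cs.IsPathElement s v g)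
    (H : ∀ w, cs.weightRep s w (weight I) (some s) = 0 ∨
      cs.weightRep s w (weight I) (some s) = -1)
    {t : I} (ht : (coxeterDiagram M).dist s v < (coxeterDiagram M).dist s t)
    (hadj : (coxeterDiagram M).Adj t v) : M t v = 3 := by
  obtain ⟨h₁, h₂⟩ := hg t ht
  have h := H (g⁻¹ * cs.simple t * g)
  have e : cs.weightRep s (g⁻¹ * cs.simple t * g) (weight I) (some s) =
      -(M.coroot s t (root v)) ^ 2 := by
    rw [map_mul, map_mul, LinearEquiv.mul_apply, LinearEquiv.mul_apply, weightRep_simple, map_sub,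
      weightRep_inv_apply, map_smul, h₁]
    simp [-map_inv, h₂]
    ring
  have hle := M.coroot_root_le (s := s) hadj
  rw [e] at h
  apply M.eq_three_of_coroot_root (s := s)
  rcases h with h | h <;> nlinarith

theorem IsPathElement.eq_of_adj {s v : I} {g : W} (hg : cs.IsPathElement s v g)
    (H : ∀ w, cs.weightRep s w (weight I) (some s) = 0 ∨
      cs.weightRep s w (weight I) (some s) = -1)
    {t u : I} (ht : (coxeterDiagram M).dist s v < (coxeterDiagram M).dist s t)
    (htv : (coxeterDiagram M).Adj t v)
    (hu : (coxeterDiagram M).dist s v < (coxeterDiagram M).dist s u)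
    (huv : (coxeterDiagram M).Adj u v) : t = u := by
  by_contra hne
  obtain ⟨h₁, h₂⟩ := hg t ht
  obtain ⟨h₃, h₄⟩ := hg u hu
  have h := H (g⁻¹ * cs.simple u * cs.simple t * g)
  have e : cs.weightRep s (g⁻¹ * cs.simple u * cs.simple t * g) (weight I) (some s) =
      -(M.coroot s t (root v)) ^ 2 - (M.coroot s u (root v)) ^ 2
        + M.coroot s t (root v) * M.coroot s u (root v) * M.coroot s u (root t) := by
    rw [map_mul, map_mul, map_mul, LinearEquiv.mul_apply, LinearEquiv.mul_apply,
      LinearEquiv.mul_apply, cs.weightRep_simple s t, h₁, weightRep_simple, map_sub, map_sub,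
      map_sub, weightRep_inv_apply, map_smul, map_smul, map_smul, h₃]
    simp [-map_inv, h₂, h₄]
    ring
  have hle₁ := M.coroot_root_le (s := s) htv
  have hle₂ := M.coroot_root_le (s := s) huv
  have hle₃ : M.coroot s u (root t) ≤ 0 := by
    by_cases hut : (coxeterDiagram M).Adj u t
    · linarith [M.coroot_root_le (s := s) hut]
    · exact (M.coroot_root_of_not_adj (Ne.symm hne) hut).le
  have hle₄ : M.coroot s t (root v) * M.coroot s u (root v) * M.coroot s u (root t) ≤ 0 :=
    mul_nonpos_of_nonneg_of_nonpos (mul_nonneg_of_nonpos_of_nonpos (by linarith) (by linarith)) hle₃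
  rw [e] at h
  rcases h with h | h <;> nlinarith

theorem isPathElement_simple (s : I) : cs.IsPathElement s s (cs.simple s) := by
  intro t ht
  have hts : t ≠ s := by
    rintro rfl
    exact lt_irrefl _ ht
  rw [cs.inv_simple, weightRep_simple, weightRep_simple, coroot_weight_self, map_sub, map_smul,
    coroot_weight_of_ne M hts, M.coroot_root_comm s s t]
  simp [hts]

theorem IsPathElement.simple_mul (hirr : (coxeterDiagram M).Connected) {s v : I} {g : W}
    (hg : cs.IsPathElement s v g) {t : I} (h3 : M t v = 3)
    (ht : (coxeterDiagram M).dist s t = (coxeterDiagram M).dist s v + 1) :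
    cs.IsPathElement s t (cs.simple t * g) := by
  intro u hu
  have hneg : M.coroot s t (root v) = -1 := by
    rw [coroot_root, h3]
    norm_num
  obtain ⟨h₁, h₂⟩ := hg t (by lia)
  obtain ⟨h₃, h₄⟩ := hg u (by lia)
  have huv : M.coroot s u (root v) = 0 := by
    apply M.coroot_root_of_not_adj
    · rintro rfl
      lia
    · intro h
      have := hirr.dist_triangle (u := s) (v := v) (w := u)
      rw [SimpleGraph.dist_eq_one_iff_adj.2 h.symm] at this
      lia
  rw [huv] at h₃ h₄
  rw [hneg] at h₁ h₂
  constructor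
  · rw [map_mul, LinearEquiv.mul_apply, weightRep_simple, map_sub, map_smul, h₁, h₃]
    simp
  · rw [mul_inv_rev, cs.inv_simple, map_mul, LinearEquiv.mul_apply, weightRep_simple, map_sub,
      map_smul, M.coroot_root_comm s t u]
    simp [-map_inv, h₂, h₄]

theorem exists_isPathElement (hirr : (coxeterDiagram M).Connected) {s : I}
    (H : ∀ w, cs.weightRep s w (weight I) (some s) = 0 ∨
      cs.weightRep s w (weight I) (some s) = -1) (v : I) : ∃ g, cs.IsPathElement s v g := by
  obtain ⟨n, hn⟩ : ∃ n, (coxeterDiagram M).dist s v = n := ⟨_, rfl⟩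
  induction n generalizing v with
  | zero =>
    obtain rfl := hirr.dist_eq_zero_iff.1 hn
    exact ⟨_, isPathElement_simple s⟩
  | succ n ih =>
    obtain ⟨u, hadj, hu⟩ := hirr.exists_adj_dist_eq hn
    obtain ⟨g, hg⟩ := ih u hu
    exact ⟨_, hg.simple_mul hirr (hg.eq_three H (by lia) hadj.symm) (by lia)⟩

/-- The distance from `s` in the diagram, increased by one, is a labelling of type `A_κ`. -/
theorem exists_typeALabelling (hirr : (coxeterDiagram M).Connected) {s : I}
    (H : ∀ w, cs.weightRep s w (weight I) (some s) = 0 ∨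
      cs.weightRep s w (weight I) (some s) = -1) :
    ∃ (κ : ℕ∞) (L : TypeALabelling M κ), L.label s = 1 := by
  have hinj : ∀ n u v, (coxeterDiagram M).dist s u = n → (coxeterDiagram M).dist s v = n →
      u = v := by
    intro n
    induction n with
    | zero =>
      intro u v hu hv
      rw [← hirr.dist_eq_zero_iff.1 hu, ← hirr.dist_eq_zero_iff.1 hv]
    | succ n ih =>
      intro u v hu hv
      obtain ⟨u', hadj, hu'⟩ := hirr.exists_adj_dist_eq hu
      obtain ⟨v', hadj', hv'⟩ := hirr.exists_adj_dist_eq hv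
      obtain rfl := ih u' v' hu' hv'
      obtain ⟨g, hg⟩ := exists_isPathElement hirr H u'
      exact hg.eq_of_adj H (by lia) hadj.symm (by lia) hadj'.symm
  have hdown : ∀ k v, ∃ u, (coxeterDiagram M).dist s u = (coxeterDiagram M).dist s v - k := by
    intro k v
    induction k with
    | zero => exact ⟨v, rfl⟩
    | succ k ih =>
      obtain ⟨u, hu⟩ := ih
      rcases Nat.eq_zero_or_pos ((coxeterDiagram M).dist s u) with h0 | h0
      · exact ⟨u, by lia⟩
      · obtain ⟨u', -, hu'⟩ := hirr.exists_adj_dist_eq (n := (coxeterDiagram M).dist s u - 1)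
          (v := u) (s := s) (by lia)
        exact ⟨u', by lia⟩
  refine ⟨⨆ v, (((coxeterDiagram M).dist s v + 1 : ℕ) : ℕ∞), {
    label := fun v => (coxeterDiagram M).dist s v + 1
    label_injective := fun u v h => hinj _ u v rfl (by simpa using h.symm)
    one_le_label := fun i => by lia
    label_le := fun i => le_iSup (fun v => (((coxeterDiagram M).dist s v + 1 : ℕ) : ℕ∞)) i
    exists_label := fun n h1 hn => ?_
    eq_three := fun i j h => ?_
    eq_two := fun i j h => ?_ }, by simp⟩
  · have : ((n - 1 : ℕ) : ℕ∞) < ⨆ v, (((coxeterDiagram M).dist s v + 1 : ℕ) : ℕ∞) :=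
      lt_of_lt_of_le (by exact_mod_cast (by lia : n - 1 < n)) hn
    obtain ⟨v, hv⟩ := lt_iSup_iff.1 this
    have hv' : n - 1 < (coxeterDiagram M).dist s v + 1 := by exact_mod_cast hv
    obtain ⟨u, hu⟩ := hdown ((coxeterDiagram M).dist s v + 1 - n) v
    exact ⟨u, by lia⟩
  · obtain ⟨u, hadj, hu⟩ := hirr.exists_adj_dist_eq (s := s) (v := j)
      (n := (coxeterDiagram M).dist s i) (by lia)
    obtain rfl := hinj _ u i hu rfl
    obtain ⟨g, hg⟩ := exists_isPathElement hirr H u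
    rw [M.symmetric]
    exact hg.eq_three H (by lia) hadj.symm
  · by_contra h2
    have hne : i ≠ j := by
      rintro rfl
      lia
    have hadj : (coxeterDiagram M).Adj i j := ⟨hne, h2⟩
    have := hirr.dist_triangle (u := s) (v := i) (w := j)
    rw [SimpleGraph.dist_eq_one_iff_adj.2 hadj] at this
    lia

end CoxeterSystem

/-! ### The permutation representation in type `A` -/

/-- The permutations of `ℕ` that preserve the initial segment `{0, …, n}`. -/
def initialStabilizer (n : ℕ) : Subgroup (Equiv.Perm ℕ) where
  carrier := {g | ∀ m, g m ≤ n ↔ m ≤ n}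
  one_mem' _ := Iff.rfl
  mul_mem' {a b} ha hb m := (ha (b m)).trans (hb m)
  inv_mem' {a} ha m := by simpa using (ha (a⁻¹ m)).symm

theorem mem_initialStabilizer_succ {n : ℕ} {g : Equiv.Perm ℕ} (hg : g ∈ initialStabilizer n)
    (h : g (n + 1) = n + 1) : g ∈ initialStabilizer (n + 1) := by
  intro m
  rcases eq_or_ne m (n + 1) with rfl | hm
  · rw [h]
  · have h₁ := hg m
    have h₂ : g m ≠ n + 1 := fun h' => hm (g.injective (h'.trans h.symm))
    lia

theorem swap_mem_initialStabilizer {n k : ℕ} (h : k ≠ n) :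
    Equiv.swap k (k + 1) ∈ initialStabilizer n := by
  intro m
  rw [Equiv.swap_apply_def]
  split_ifs <;> lia

theorem lt_of_lt_succ {m : ℕ} {f : ℕ → ℕ} (h : ∀ j, 1 ≤ j → j < m → f j < f (j + 1)) {a b : ℕ}
    (ha : 1 ≤ a) (hab : a < b) (hb : b ≤ m) : f a < f b := by
  induction b, hab using Nat.le_induction with
  | base => exact h a ha (by lia)
  | succ b hab ih => exact (ih (by lia)).trans (h b (by lia) (by lia))

theorem swap_mul_swap_pow_three {a b c : ℕ} (hab : a ≠ b) (hac : a ≠ c) (hbc : b ≠ c) :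
    (Equiv.swap a b * Equiv.swap b c) ^ 3 = 1 := by
  have h₁ := Equiv.swap_mul_swap_mul_swap hbc.symm hac.symm
  have h₂ := Equiv.swap_mul_swap_mul_swap hab hac
  rw [Equiv.swap_comm c b] at h₁
  calc (Equiv.swap a b * Equiv.swap b c) ^ 3
      = (Equiv.swap a b * Equiv.swap b c * Equiv.swap a b) *
        (Equiv.swap b c * Equiv.swap a b * Equiv.swap b c) := by
        simp only [pow_succ, pow_zero, one_mul, mul_assoc]
    _ = 1 := by
      rw [Equiv.swap_comm b a] at h₁
      rw [h₁, h₂, Equiv.swap_comm c a, Equiv.swap_mul_self]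

namespace TypeALabelling

variable {I W C : Type*} [Group W] {M : CoxeterMatrix I} {κ : ℕ∞} (L : TypeALabelling M κ)
  (cs : CoxeterSystem M W)

theorem isLiftable_swap : M.IsLiftable fun i => Equiv.swap (L.label i) (L.label i + 1) := by
  intro i j
  have h3 {i j : I} (h : L.label i + 1 = L.label j) :
      (Equiv.swap (L.label i) (L.label i + 1) * Equiv.swap (L.label j) (L.label j + 1)) ^ M i j
        = 1 := by
    rw [L.eq_three i j h, ← h]
    exact swap_mul_swap_pow_three (by lia) (by lia) (by lia)
  have h2 {i j : I} (h : L.label i + 1 < L.label j) :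
      Commute (Equiv.swap (L.label i) (L.label i + 1))
        (Equiv.swap (L.label j) (L.label j + 1)) := by
    refine Equiv.Perm.Disjoint.commute fun m => ?_
    rw [Equiv.swap_apply_def, Equiv.swap_apply_def]
    split_ifs <;> lia
  have h2' {i j : I} (h : L.label i + 1 < L.label j) :
      (Equiv.swap (L.label i) (L.label i + 1) * Equiv.swap (L.label j) (L.label j + 1)) ^ M i j
        = 1 := by
    rw [L.eq_two i j h, (h2 h).mul_pow, pow_two, pow_two, Equiv.swap_mul_self, Equiv.swap_mul_self,
      one_mul]
  have hsymm {a b : Equiv.Perm ℕ} (hba : (b * a) ^ M j i = 1) : (a * b) ^ M i j = 1 := by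
    rw [M.symmetric]
    have : a * b = a * (b * a) * a⁻¹ := by group
    rw [this, conj_pow, hba, mul_one, mul_inv_cancel]
  rcases lt_trichotomy (L.label i) (L.label j) with h | h | h
  · rcases (show L.label i + 1 ≤ L.label j from h).eq_or_lt with h | h
    exacts [h3 h, h2' h]
  · rw [L.label_injective h, M.diagonal, pow_one, Equiv.swap_mul_self]
  · rcases (show L.label j + 1 ≤ L.label i from h).eq_or_lt with h | h
    exacts [hsymm (h3 h), hsymm (h2' h)]

/-- The action of `W` on the natural numbers in which the generator with label `n` interchanges `n`
and `n + 1`. -/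
def perm : W →* Equiv.Perm ℕ := cs.lift ⟨_, L.isLiftable_swap⟩

@[simp] theorem perm_simple (i : I) :
    L.perm cs (cs.simple i) = Equiv.swap (L.label i) (L.label i + 1) :=
  cs.lift_apply_simple L.isLiftable_swap i

theorem perm_mul_simple (w : W) (i : I) (m : ℕ) :
    L.perm cs (w * cs.simple i) m =
      L.perm cs w (Equiv.swap (L.label i) (L.label i + 1) m) := by
  rw [map_mul, perm_simple, Equiv.Perm.mul_apply]

theorem perm_mul_simple_of_ne (w : W) (i : I) {m : ℕ} (h₁ : m ≠ L.label i)
    (h₂ : m ≠ L.label i + 1) : L.perm cs (w * cs.simple i) m = L.perm cs w m := by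
  rw [perm_mul_simple, Equiv.swap_apply_of_ne_of_ne h₁ h₂]

theorem perm_mul_simple_label (w : W) (i : I) :
    L.perm cs (w * cs.simple i) (L.label i) = L.perm cs w (L.label i + 1) := by
  rw [perm_mul_simple, Equiv.swap_apply_left]

theorem perm_mul_simple_label_succ (w : W) (i : I) :
    L.perm cs (w * cs.simple i) (L.label i + 1) = L.perm cs w (L.label i) := by
  rw [perm_mul_simple, Equiv.swap_apply_right]

theorem simple_mul_simple_comm {i j : I}
    (h : L.label i + 1 < L.label j ∨ L.label j + 1 < L.label i) :
    cs.simple i * cs.simple j = cs.simple j * cs.simple i := by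
  have h2 : M i j = 2 := by
    rcases h with h | h
    · exact L.eq_two i j h
    · rw [M.symmetric]
      exact L.eq_two j i h
  have := cs.simple_mul_simple_pow i j
  rw [h2, pow_two] at this
  rw [eq_inv_of_mul_eq_one_left this, mul_inv_rev, cs.inv_simple, cs.inv_simple]

theorem simple_mul_simple_mul_simple {i j : I}
    (h : L.label i + 1 = L.label j ∨ L.label j + 1 = L.label i) :
    cs.simple i * cs.simple j * cs.simple i = cs.simple j * cs.simple i * cs.simple j := by
  have h3 : M i j = 3 := by
    rcases h with h | h
    · exact L.eq_three i j h
    · rw [M.symmetric]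
      exact L.eq_three j i h
  have h' := cs.simple_mul_simple_pow i j
  rw [h3] at h'
  have h'' : cs.simple i * cs.simple j * cs.simple i *
      (cs.simple j * cs.simple i * cs.simple j) = 1 := by
    simpa only [pow_succ, pow_zero, one_mul, mul_assoc] using h'
  rw [eq_inv_of_mul_eq_one_left h'', mul_inv_rev, mul_inv_rev, cs.inv_simple, cs.inv_simple,
    mul_assoc]

/-- Where the length goes up, so does the permutation. The proof is by induction on the length and
splits off the part of `w` in the dihedral group that is generated by `i` and a descent of `w`. -/
theorem perm_lt_of_not_isRightDescent {w : W} {i : I} (h : ¬ cs.IsRightDescent w i) :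
    L.perm cs w (L.label i) < L.perm cs w (L.label i + 1) := by
  obtain ⟨n, hn⟩ : ∃ n, cs.length w = n := ⟨_, rfl⟩
  induction n using Nat.strong_induction_on generalizing w i with
  | _ n ih =>
  by_cases hw : w = 1
  · simp [hw]
  obtain ⟨j, hj⟩ := cs.exists_rightDescent_of_ne_one hw
  have hij : i ≠ j := by
    rintro rfl
    exact h hj
  obtain ⟨v, rfl⟩ : ∃ v, w = v * cs.simple j := ⟨w * cs.simple j, by simp⟩
  have hvj := cs.isRightDescent_iff_not_isRightDescent_mul.1 hj
  rw [cs.simple_mul_simple_cancel_right] at hvj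
  have hlv := cs.not_isRightDescent_iff.1 hvj
  have hlw := cs.not_isRightDescent_iff.1 h
  have hne := L.label_injective.ne hij
  by_cases hfar : L.label i + 1 < L.label j ∨ L.label j + 1 < L.label i
  · rw [perm_mul_simple_of_ne _ _ _ _ (by lia) (by lia),
      perm_mul_simple_of_ne _ _ _ _ (by lia) (by lia)]
    refine ih _ (by lia) (fun hvi => ?_) rfl
    rw [cs.isRightDescent_iff] at hvi
    have := cs.length_mul_le (v * cs.simple i) (cs.simple j)
    rw [cs.length_simple, mul_assoc, L.simple_mul_simple_comm cs hfar, ← mul_assoc] at this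
    lia
  have hnear : L.label i + 1 = L.label j ∨ L.label j + 1 = L.label i := by lia
  by_cases hvi : cs.IsRightDescent v i
  · obtain ⟨u, rfl⟩ : ∃ u, v = u * cs.simple i := ⟨v * cs.simple i, by simp⟩
    have hui := cs.isRightDescent_iff_not_isRightDescent_mul.1 hvi
    rw [cs.simple_mul_simple_cancel_right] at hui
    have hlu := cs.not_isRightDescent_iff.1 hui
    have huj : ¬ cs.IsRightDescent u j := by
      intro huj
      -- Then `w = u' s_j s_i s_j = u' s_i s_j s_i`, so that `i` is a descent of `w`.
      obtain ⟨u', rfl⟩ : ∃ u', u = u' * cs.simple j := ⟨u * cs.simple j, by simp⟩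
      rw [cs.isRightDescent_iff, cs.simple_mul_simple_cancel_right] at huj
      have e : u' * cs.simple j * cs.simple i * cs.simple j * cs.simple i =
          u' * cs.simple i * cs.simple j := by
        have := L.simple_mul_simple_mul_simple cs hnear
        rw [mul_assoc u', mul_assoc u', ← this]
        simp [← mul_assoc]
      rw [e] at hlw
      have h₁ := cs.length_mul_le (u' * cs.simple i) (cs.simple j)
      have h₂ := cs.length_mul_le u' (cs.simple i)
      rw [cs.length_simple] at h₁ h₂
      lia
    have h₁ := ih _ (by lia) hui rfl
    have h₂ := ih _ (by lia) huj rfl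
    simp only [perm_mul_simple, Equiv.swap_apply_def]
    rcases hnear with hnear | hnear
    · rw [← hnear] at h₂ ⊢
      split_ifs <;> lia
    · rw [← hnear] at h₁ ⊢
      split_ifs <;> lia
  · have h₁ := ih _ (by lia) hvi rfl
    have h₂ := ih _ (by lia) hvj rfl
    simp only [perm_mul_simple, Equiv.swap_apply_def]
    rcases hnear with hnear | hnear
    · rw [← hnear] at h₂ ⊢
      split_ifs <;> lia
    · rw [← hnear] at h₁ ⊢
      split_ifs <;> lia

theorem isRightDescent_iff_perm_lt {w : W} {i : I} :
    cs.IsRightDescent w i ↔ L.perm cs w (L.label i + 1) < L.perm cs w (L.label i) := by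
  constructor
  · intro h
    have := L.perm_lt_of_not_isRightDescent cs (cs.isRightDescent_iff_not_isRightDescent_mul.1 h)
    rwa [perm_mul_simple_label, perm_mul_simple_label_succ] at this
  · intro h
    by_contra h'
    exact lt_asymm h (L.perm_lt_of_not_isRightDescent cs h')

/-- The nodes whose label is not `n`. If no node has the label `n`, these are all the nodes. -/
def ne (n : ℕ) : Set I := {i | L.label i ≠ n}

theorem ne_label (i : I) : L.ne (L.label i) = {i}ᶜ :=
  Set.ext fun _ => L.label_injective.ne_iff

theorem perm_simple_mem {n : ℕ} {i : I} (hi : i ∈ L.ne n) :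
    cs.simple i ∈ (initialStabilizer n).comap (L.perm cs) := by
  rw [Subgroup.mem_comap, perm_simple]
  exact swap_mem_initialStabilizer hi

end TypeALabelling

/-! ### Points and flats of a building of type `A` -/

namespace Building

variable {I W C : Type*} [Group W] {M : CoxeterMatrix I} {cs : CoxeterSystem M W}
  (Δ : Building cs C) {κ : ℕ∞} (L : TypeALabelling M κ)

/-- Two chambers agree in type `n` if they lie in the same residue of the type consisting of all
nodes whose label is not `n`. If `n` is a label, this means that they have the same element of type
`n`; otherwise it is no condition. -/
def Agree (n : ℕ) (c d : C) : Prop := Δ.adjJ (L.ne n) c d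

variable {Δ L}

theorem Agree.refl (n : ℕ) (c : C) : Δ.Agree L n c c := (Δ.adjJ _).refl c

theorem Agree.symm {n : ℕ} {c d : C} (h : Δ.Agree L n c d) : Δ.Agree L n d c := (Δ.adjJ _).symm h

theorem Agree.trans {n : ℕ} {c d e : C} (h : Δ.Agree L n c d) (h' : Δ.Agree L n d e) :
    Δ.Agree L n c e := (Δ.adjJ _).trans h h'

theorem agree_of_adj {n : ℕ} {i : I} (hi : L.label i ≠ n) {c d : C} (h : Δ.adj i c d) :
    Δ.Agree L n c d := Δ.adjJ_of_adj hi h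

/-- Chambers agree in type `n` if and only if their distance preserves `{1, …, n}`. -/
theorem agree_iff {n : ℕ} {c d : C} :
    Δ.Agree L n c d ↔ L.perm cs (Δ.δ c d) ∈ initialStabilizer n := by
  constructor
  · intro h
    exact Δ.δ_mem_of_adjJ (fun j hj => L.perm_simple_mem cs hj) h
  · intro h
    obtain ⟨k, hk⟩ : ∃ k, cs.length (Δ.δ c d) = k := ⟨_, rfl⟩
    induction k generalizing d with
    | zero =>
      obtain rfl := Δ.δ_eq_one_iff.1 (cs.length_eq_zero_iff.1 hk)
      exact Agree.refl n c
    | succ k ih =>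
      have hne : Δ.δ c d ≠ 1 := by
        intro h1
        simp [h1] at hk
      obtain ⟨j, hj⟩ := cs.exists_rightDescent_of_ne_one hne
      -- A permutation that preserves `{1, …, n}` does not have a descent at `n`.
      have hjn : L.label j ≠ n := by
        have h₁ := (L.isRightDescent_iff_perm_lt cs).1 hj
        rintro rfl
        have h₂ := h (L.label j)
        have h₃ := h (L.label j + 1)
        lia
      obtain ⟨e, -, hed, he⟩ := Δ.exists_adj_of_descent c d hj
      refine (ih ?_ ?_).trans (agree_of_adj hjn hed)
      · rw [he, map_mul]
        exact mul_mem h (L.perm_simple_mem cs hjn)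
      · rw [cs.isRightDescent_iff] at hj
        rw [he]
        lia

theorem agree_zero (c d : C) : Δ.Agree L 0 c d := by
  rw [agree_iff]
  have h : ∀ w, L.perm cs w ∈ initialStabilizer 0 := by
    intro w
    induction w using cs.simple_induction_right with
    | one => simp
    | mul_simple_right w i ih =>
      rw [map_mul]
      exact mul_mem ih (L.perm_simple_mem cs (Nat.one_le_iff_ne_zero.1 (L.one_le_label i)))
  exact h _

variable (Δ) in
/-- The position of a point `x` in the flag of a chamber `c`: the least `n` such that the element
of type `n` of `c` is incident with `x`. It can be read off from the distance from `c` to any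
chamber in `x`. -/
noncomputable def pos (L : TypeALabelling M κ) {p : I} (c : C) (x : Δ.Vertex p) : ℕ :=
  L.perm cs (Δ.δ c (Δ.residue_nonempty x).some) 1

variable {p : I} {x y : Δ.Vertex p} {c d e : C} {n m k : ℕ}

theorem perm_one_of_adjJ (hp : L.label p = 1) (c : C) (h : Δ.adjJ {p}ᶜ d e) :
    L.perm cs (Δ.δ c d) 1 = L.perm cs (Δ.δ c e) 1 := by
  let P : Subgroup W := (MulAction.stabilizer (Equiv.Perm ℕ) 1).comap (L.perm cs)
  have hP : ∀ j ∈ ({p}ᶜ : Set I), cs.simple j ∈ P := by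
    intro j (hj : j ≠ p)
    change L.perm cs (cs.simple j) 1 = 1
    have h₁ := L.one_le_label j
    have h₂ := L.label_injective.ne hj
    rw [L.perm_simple, Equiv.swap_apply_of_ne_of_ne (by lia) (by lia)]
  have h' : L.perm cs ((Δ.δ c d)⁻¹ * Δ.δ c e) 1 = 1 := Δ.inv_mul_δ_mem_of_adjJ hP c h
  rw [map_mul, map_inv, Equiv.Perm.mul_apply, Equiv.Perm.inv_eq_iff_eq] at h'
  exact h'.symm

theorem pos_eq (hp : L.label p = 1) (c : C) (hd : d ∈ x.1) :
    Δ.pos L c x = L.perm cs (Δ.δ c d) 1 :=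
  perm_one_of_adjJ hp c (Δ.adjJ_of_mem (Δ.residue_nonempty x).some_mem hd)

/-- All positions lie between `1` and `κ + 1`. -/
theorem perm_mem_range (w : W) (hm : 1 ≤ m ∧ (m : ℕ∞) ≤ κ + 1) :
    1 ≤ L.perm cs w m ∧ (L.perm cs w m : ℕ∞) ≤ κ + 1 := by
  induction w using cs.simple_induction_left with
  | one => simpa using hm
  | mul_simple_left w i ih =>
    rw [map_mul, L.perm_simple, Equiv.Perm.mul_apply, Equiv.swap_apply_def]
    have h₁ := L.one_le_label i
    have h₂ : (L.label i : ℕ∞) + 1 ≤ κ + 1 := by gcongr; exact L.label_le i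
    split_ifs
    · exact ⟨by lia, by exact_mod_cast h₂⟩
    · exact ⟨h₁, le_self_add.trans h₂⟩
    · exact ih

theorem one_le_pos : 1 ≤ Δ.pos L c x := (perm_mem_range _ ⟨le_rfl, by simp⟩).1

theorem pos_le : (Δ.pos L c x : ℕ∞) ≤ κ + 1 := (perm_mem_range _ ⟨le_rfl, by simp⟩).2

theorem pos_eq_one_iff (hp : L.label p = 1) : Δ.pos L c x = 1 ↔ c ∈ x.1 := by
  constructor
  · intro h
    obtain ⟨d, hd⟩ := Δ.residue_nonempty x
    rw [pos_eq hp c hd] at h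
    refine Δ.mem_of_adjJ hd ?_
    rw [← L.ne_label, hp]
    have h0 := agree_iff.1 (agree_zero (Δ := Δ) (L := L) c d)
    exact (agree_iff.2 (mem_initialStabilizer_succ h0 h)).symm
  · intro h
    rw [pos_eq hp c h, Δ.δ_self]
    simp

theorem exists_adj_pos_eq (hp : L.label p = 1) (c : C) (x : Δ.Vertex p) (i : I) :
    ∃ d, Δ.adj i c d ∧ Δ.pos L d x = Equiv.swap (L.label i) (L.label i + 1) (Δ.pos L c x) := by
  obtain ⟨e, he⟩ := Δ.residue_nonempty x
  obtain ⟨d, hd, h⟩ := Δ.exists_adj_δ_eq i e c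
  refine ⟨d, hd, ?_⟩
  rw [pos_eq hp c he, pos_eq hp d he, Δ.δ_symm e c, Δ.δ_symm e d, h, mul_inv_rev, cs.inv_simple,
    map_mul, L.perm_simple, Equiv.Perm.mul_apply]

theorem exists_label_eq_pred (h1 : 1 ≤ n) (h : ((n + 1 : ℕ) : ℕ∞) ≤ κ + 1) :
    ∃ i, L.label i = n := by
  refine L.exists_label n h1 ?_
  rw [Nat.cast_add, Nat.cast_one] at h
  exact (ENat.add_le_add_iff_right ENat.one_ne_top).1 h

/-- The flag of a chamber can be changed below the position of a point so as to reach that point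
earlier. -/
theorem exists_agree_pos_eq (hp : L.label p = 1) (c : C) (x : Δ.Vertex p) (h1 : 1 ≤ m)
    (hm : m ≤ Δ.pos L c x) :
    ∃ d, Δ.pos L d x = m ∧ ∀ n, n < m ∨ Δ.pos L c x ≤ n → Δ.Agree L n c d := by
  obtain ⟨k, hk⟩ := Nat.exists_eq_add_of_le hm
  induction k generalizing c with
  | zero => exact ⟨c, by simpa using hk, fun n _ => Agree.refl n c⟩
  | succ k ih =>
    obtain ⟨i, hi⟩ := exists_label_eq_pred (L := L) (n := m + k) (by lia)
      (by rw [add_assoc, ← hk]; exact pos_le)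
    obtain ⟨d, hcd, hd⟩ := exists_adj_pos_eq hp c x i
    rw [hk, hi, ← add_assoc, Equiv.swap_apply_right] at hd
    obtain ⟨e, he, h⟩ := ih d (by lia) hd
    exact ⟨e, he, fun n hn => (agree_of_adj (by lia) hcd).trans (h n (by lia))⟩

/-- If the distance `w` from `e` to `c` takes at `k` a larger value than at all smaller positive
integers, then it maps positions `k` with respect to `c` to positions with respect to `e`. -/
theorem pos_eq_perm (hp : L.label p = 1) (hk : Δ.pos L c x = k)
    (h : ∀ j, 1 ≤ j → j < k → L.perm cs (Δ.δ e c) j < L.perm cs (Δ.δ e c) k) :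
    Δ.pos L e x = L.perm cs (Δ.δ e c) k := by
  have h1 : 1 ≤ k := hk ▸ one_le_pos
  induction k, h1 using Nat.le_induction generalizing c with
  | base => exact pos_eq hp e ((pos_eq_one_iff hp).1 hk)
  | succ k h1 ih =>
    obtain ⟨i, hi⟩ := exists_label_eq_pred (L := L) h1 (hk ▸ pos_le (c := c) (x := x))
    obtain ⟨d, hcd, hd⟩ := exists_adj_pos_eq hp c x i
    rw [hk, hi, Equiv.swap_apply_right] at hd
    have hne : c ≠ d := by
      rintro rfl
      lia
    have hδ : Δ.δ e d = Δ.δ e c * cs.simple i := by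
      refine Δ.δ_of_adj_of_not_descent e hne hcd fun hdes => ?_
      have h₁ := (L.isRightDescent_iff_perm_lt cs).1 hdes
      rw [hi] at h₁
      exact lt_asymm h₁ (h k h1 (by lia))
    have hkk : L.perm cs (Δ.δ e d) k = L.perm cs (Δ.δ e c) (k + 1) := by
      rw [hδ, ← hi, L.perm_mul_simple_label]
    rw [← hkk]
    refine ih hd fun j hj hjk => ?_
    rw [hkk, hδ, L.perm_mul_simple_of_ne _ _ _ (by lia) (by lia)]
    exact h j hj (by lia)

theorem exists_pos_eq (hp : L.label p = 1) (c : C) (h1 : 1 ≤ m) (hm : (m : ℕ∞) ≤ κ + 1) :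
    ∃ x : Δ.Vertex p, Δ.pos L c x = m := by
  obtain ⟨w, hw⟩ : ∃ w : W, L.perm cs w 1 = m := by
    induction m, h1 using Nat.le_induction with
    | base => exact ⟨1, by simp⟩
    | succ m h1 ih =>
      obtain ⟨w, hw⟩ := ih (le_trans (by exact_mod_cast Nat.le_succ m) hm)
      obtain ⟨i, hi⟩ := exists_label_eq_pred (L := L) h1 hm
      exact ⟨cs.simple i * w, by
        rw [map_mul, Equiv.Perm.mul_apply, hw, L.perm_simple, hi, Equiv.swap_apply_left]⟩
  obtain ⟨d, hd⟩ := Δ.exists_δ_eq c w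
  exact ⟨Δ.residueOf _ d, by rw [pos_eq hp c (Δ.mem_residueOf _ d), hd, hw]⟩

theorem Agree.pos_le (hp : L.label p = 1) (h : Δ.Agree L n c d) (hx : Δ.pos L d x ≤ n) :
    Δ.pos L c x ≤ n := by
  obtain ⟨e, he, h'⟩ := exists_agree_pos_eq hp d x le_rfl one_le_pos
  rw [pos_eq hp c ((pos_eq_one_iff hp).1 he)]
  have h₁ := agree_iff.1 (h.trans (h' n (.inr hx))) 1
  exact h₁.2 (one_le_pos.trans hx)

/-- If two chambers agree in type `n` and a point comes next in both flags, then they agree in type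
`n + 1`. -/
theorem Agree.succ (hp : L.label p = 1) (h : Δ.Agree L n c d) (hc : Δ.pos L c x = n + 1)
    (hd : Δ.pos L d x = n + 1) : Δ.Agree L (n + 1) c d := by
  rw [agree_iff] at h ⊢
  refine mem_initialStabilizer_succ h ?_
  rw [← pos_eq_perm hp hd, hc]
  intro j hj hjn
  have h₁ := h j
  have h₂ := h (n + 1)
  lia

theorem exists_join (hp : L.label p = 1) (hxy : x ≠ y) (hx : Δ.pos L c x ≤ n)
    (hy : Δ.pos L c y ≤ n) :
    ∃ d, Δ.Agree L n c d ∧ Δ.pos L d x = 1 ∧ Δ.pos L d y = 2 := by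
  obtain ⟨d, hd, h⟩ := exists_agree_pos_eq hp c x le_rfl one_le_pos
  have hdy : 2 ≤ Δ.pos L d y := by
    by_contra! h2
    have h1 : Δ.pos L d y = 1 := le_antisymm (by lia) one_le_pos
    exact hxy (Δ.residue_eq ((pos_eq_one_iff hp).1 hd) ((pos_eq_one_iff hp).1 h1))
  obtain ⟨e, he, h'⟩ := exists_agree_pos_eq hp d y (by lia) hdy
  have hdn := h n (.inr hx)
  refine ⟨e, hdn.trans (h' n (.inr (hdn.symm.pos_le hp hy))), ?_, he⟩
  exact le_antisymm ((h' 1 (by lia)).symm.pos_le hp hd.le) one_le_pos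

variable (Δ) in
/-- The points incident with the element of type `n` of the chamber `c`; for `n = κ + 1` these are
all the points. -/
def flat (L : TypeALabelling M κ) (p : I) (c : C) (n : ℕ) : Set (Δ.Vertex p) :=
  {x | Δ.pos L c x ≤ n}

theorem mem_flat : x ∈ Δ.flat L p c n ↔ Δ.pos L c x ≤ n := Iff.rfl

theorem Agree.flat_eq (hp : L.label p = 1) (h : Δ.Agree L n c d) :
    Δ.flat L p c n = Δ.flat L p d n :=
  Set.ext fun _ => ⟨fun hx => h.symm.pos_le hp hx, fun hx => h.pos_le hp hx⟩

theorem flat_mono (h : m ≤ n) : Δ.flat L p c m ⊆ Δ.flat L p c n := fun _ hx => le_trans hx h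

theorem flat_eq_univ (h : κ + 1 ≤ n) : Δ.flat L p c n = Set.univ := by
  refine Set.eq_univ_of_forall fun x => ?_
  exact_mod_cast (pos_le (c := c) (x := x) (L := L)).trans h

/-- An inclusion between flats of ranks `n` and `m` is realized by the flag of a single chamber.
Indeed, the distance between chambers of minimal distance with these flats has no descents other
than `m` on the right and `n` on the left, and the inclusion excludes the descent `n`. -/
theorem exists_agree_of_flat_subset (hp : L.label p = 1) (hn : (n : ℕ∞) ≤ κ + 1)
    (hm : (m : ℕ∞) ≤ κ + 1) (h : Δ.flat L p c n ⊆ Δ.flat L p d m) :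
    ∃ e, Δ.Agree L n c e ∧ Δ.Agree L m d e := by
  let S : Set ℕ := {k | ∃ c' d', Δ.Agree L n c c' ∧ Δ.Agree L m d d' ∧ cs.length (Δ.δ d' c') = k}
  have hS : S.Nonempty := ⟨_, c, d, Agree.refl n c, Agree.refl m d, rfl⟩
  obtain ⟨c', d', hc, hd, hlen⟩ := Nat.sInf_mem hS
  have hmin {c'' d'' : C} (hc : Δ.Agree L n c c'') (hd : Δ.Agree L m d d'') :
      cs.length (Δ.δ d' c') ≤ cs.length (Δ.δ d'' c'') :=
    hlen.trans_le (Nat.sInf_le ⟨c'', d'', hc, hd, rfl⟩)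
  rw [hc.flat_eq hp, hd.flat_eq hp] at h
  have hdesc_c {i : I} (hi : cs.IsRightDescent (Δ.δ d' c') i) : L.label i = n := by
    by_contra hne
    obtain ⟨e, -, he, hδ⟩ := Δ.exists_adj_of_descent d' c' hi
    have := hmin (hc.trans (agree_of_adj hne he).symm) hd
    rw [hδ] at this
    exact this.not_gt hi
  have hdesc_d {i : I} (hi : cs.IsRightDescent (Δ.δ c' d') i) : L.label i = m := by
    by_contra hne
    obtain ⟨e, -, he, hδ⟩ := Δ.exists_adj_of_descent c' d' hi
    have := hmin hc (hd.trans (agree_of_adj hne he).symm)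
    rw [Δ.δ_symm c' d', Δ.δ_symm c' e, cs.length_inv, cs.length_inv, hδ] at this
    exact this.not_gt hi
  have hmono {f : ℕ} {a b : C} (hf : (f : ℕ∞) ≤ κ + 1)
      (hdes : ∀ {i}, cs.IsRightDescent (Δ.δ a b) i → L.label i = f) (j : ℕ) (h1 : 1 ≤ j)
      (hj : j < f) : L.perm cs (Δ.δ a b) j < L.perm cs (Δ.δ a b) (j + 1) := by
    obtain ⟨i, rfl⟩ := exists_label_eq_pred (L := L) h1
      (le_trans (by exact_mod_cast hj : ((j + 1 : ℕ) : ℕ∞) ≤ f) hf)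
    exact L.perm_lt_of_not_isRightDescent cs fun hi => hj.ne (hdes hi)
  have himage {k : ℕ} (h1 : 1 ≤ k) (hk : k ≤ n) : L.perm cs (Δ.δ d' c') k ≤ m := by
    obtain ⟨x, hx⟩ := exists_pos_eq (Δ := Δ) (p := p) hp c' h1
      (le_trans (by exact_mod_cast hk) hn)
    rw [← pos_eq_perm hp hx fun j hj hjk =>
      lt_of_lt_succ (f := L.perm cs (Δ.δ d' c')) (hmono hn hdesc_c) hj hjk hk]
    exact h (show Δ.pos L c' x ≤ n from hx.trans_le hk)
  suffices hone : Δ.δ d' c' = 1 by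
    obtain rfl := Δ.δ_eq_one_iff.1 hone
    exact ⟨d', hc, hd⟩
  by_contra hne
  obtain ⟨i, hi⟩ := cs.exists_rightDescent_of_ne_one hne
  have hin := hdesc_c hi
  rw [L.isRightDescent_iff_perm_lt] at hi
  have hle := himage (L.one_le_label i) hin.le
  have hlt := lt_of_lt_succ (f := L.perm cs (Δ.δ c' d')) (hmono hm hdesc_d)
    (perm_mem_range (L := L) (cs := cs) _ ?_).1 hi hle
  · have hinv (a : ℕ) : L.perm cs (Δ.δ c' d') (L.perm cs (Δ.δ d' c') a) = a := by
      rw [Δ.δ_symm d' c', ← Equiv.Perm.mul_apply, ← map_mul, inv_mul_cancel, map_one,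
        Equiv.Perm.one_apply]
    rw [hinv, hinv] at hlt
    lia
  · refine ⟨by lia, ?_⟩
    rw [Nat.cast_add, Nat.cast_one]
    gcongr
    exact L.label_le i

theorem le_of_flat_subset (hp : L.label p = 1) (hn : (n : ℕ∞) ≤ κ + 1)
    (hm : (m : ℕ∞) ≤ κ + 1) (h : Δ.flat L p c n ⊆ Δ.flat L p d m) : n ≤ m := by
  rcases Nat.eq_zero_or_pos n with rfl | h0
  · exact Nat.zero_le m
  obtain ⟨e, hc, hd⟩ := exists_agree_of_flat_subset hp hn hm h
  rw [hc.flat_eq hp, hd.flat_eq hp] at h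
  obtain ⟨x, hx⟩ := exists_pos_eq (Δ := Δ) (p := p) hp e h0 hn
  have : Δ.pos L e x ≤ m := h (show Δ.pos L e x ≤ n from hx.le)
  lia

end Building

/-! ### Spans in projective spaces -/

namespace ProjectiveSpace

variable {P : Type*} (S : ProjectiveSpace P)

theorem subset_span (A : Set P) : A ⊆ S.span A := Set.subset_sInter fun _ h => h.2

theorem span_subset {A X : Set P} (hX : S.IsSubspace X) (h : A ⊆ X) : S.span A ⊆ X :=
  Set.sInter_subset_of_mem ⟨hX, h⟩

theorem isSubspace_span (A : Set P) : S.IsSubspace (S.span A) :=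
  fun a ha b hb hab l hl hal hbl => Set.subset_sInter fun X hX =>
    hX.1 a (ha X hX) b (hb X hX) hab l hl hal hbl

theorem span_mono {A B : Set P} (h : A ⊆ B) : S.span A ⊆ S.span B :=
  S.span_subset (S.isSubspace_span B) (h.trans (S.subset_span B))

theorem span_eq_self {X : Set P} (hX : S.IsSubspace X) : S.span X = X :=
  (S.span_subset hX subset_rfl).antisymm (S.subset_span X)

theorem span_insert_span (x : P) (A : Set P) : S.span (insert x (S.span A)) = S.span (insert x A) :=
  (S.span_subset (S.isSubspace_span _) (Set.insert_subset
    (S.subset_span _ (Set.mem_insert x A)) (S.span_mono (Set.subset_insert x A)))).antisymm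
    (S.span_mono (Set.insert_subset_insert (S.subset_span A)))

theorem exists_span_eq_of_rank_eq {X : Set P} {n : ℕ} (h : S.rank X = n) :
    ∃ A, S.span A = X ∧ A.encard = n := by
  have hlt : S.rank X < (n + 1 : ℕ) := by
    rw [h]
    exact_mod_cast Nat.lt_succ_self n
  obtain ⟨A, hA⟩ := iInf_lt_iff.1 hlt
  obtain ⟨hAX, hA⟩ := iInf_lt_iff.1 hA
  refine ⟨A, hAX, le_antisymm ?_ (h ▸ iInf₂_le A hAX)⟩
  rw [Nat.cast_add, Nat.cast_one] at hA
  exact Order.le_of_lt_add_one hA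

end ProjectiveSpace

/-! ### The projective space of a building of type `A` -/

namespace Building

variable {I W C : Type*} [Group W] {M : CoxeterMatrix I} {cs : CoxeterSystem M W}
  {Δ : Building cs C} {κ : ℕ∞} {L : TypeALabelling M κ} {p : I}
  {x y : Δ.Vertex p} {c d e : C} {n m k : ℕ}

theorem flat_two_eq (hp : L.label p = 1) (hxy : x ≠ y) (hx : x ∈ Δ.flat L p c 2)
    (hy : y ∈ Δ.flat L p c 2) (hx' : x ∈ Δ.flat L p d 2) (hy' : y ∈ Δ.flat L p d 2) :
    Δ.flat L p c 2 = Δ.flat L p d 2 := by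
  obtain ⟨c', hc, hcx, hcy⟩ := exists_join hp hxy hx hy
  obtain ⟨d', hd, hdx, hdy⟩ := exists_join hp hxy hx' hy'
  rw [hc.flat_eq hp, hd.flat_eq hp]
  exact (((agree_zero c' d').succ hp hcx hdx).succ hp hcy hdy).flat_eq hp

/-- A line with two points in a flat is the line of the flag of a chamber that contains the flat. -/
theorem exists_flat_two_eq (hp : L.label p = 1) (hxy : x ≠ y) (hx : x ∈ Δ.flat L p c n)
    (hy : y ∈ Δ.flat L p c n) (hx' : x ∈ Δ.flat L p d 2) (hy' : y ∈ Δ.flat L p d 2) :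
    ∃ e, Δ.Agree L n c e ∧ Δ.pos L e x = 1 ∧ Δ.pos L e y = 2 ∧
      Δ.flat L p d 2 = Δ.flat L p e 2 := by
  obtain ⟨e, he, hex, hey⟩ := exists_join hp hxy hx hy
  refine ⟨e, he, hex, hey, flat_two_eq hp hxy hx' hy' ?_ hey.le⟩
  exact hex.le.trans one_le_two

theorem flat_two_subset (hp : L.label p = 1) (hxy : x ≠ y) (hx : x ∈ Δ.flat L p c n)
    (hy : y ∈ Δ.flat L p c n) (hx' : x ∈ Δ.flat L p d 2) (hy' : y ∈ Δ.flat L p d 2) :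
    Δ.flat L p d 2 ⊆ Δ.flat L p c n := by
  obtain ⟨e, he, hex, hey, h⟩ := exists_flat_two_eq hp hxy hx hy hx' hy'
  rw [h, he.flat_eq hp]
  refine flat_mono ?_
  rw [← hey]
  exact he.symm.pos_le hp hy

theorem three_le_encard_flat_two (hthick : Δ.IsThick) (hp : L.label p = 1) (c : C) :
    3 ≤ (Δ.flat L p c 2).encard := by
  have hinj : Set.InjOn (Δ.residueOf {p}ᶜ) {y | Δ.adj p c y} := by
    intro y hy z hz hyz
    by_contra hne
    have h₁ := Δ.δ_of_adj hne ((Δ.adj p).trans ((Δ.adj p).symm hy) hz)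
    have hmem : z ∈ (Δ.residueOf {p}ᶜ y).1 := by
      rw [hyz]
      exact Δ.mem_residueOf _ z
    have h₂ := Δ.adjJ_of_mem (Δ.mem_residueOf {p}ᶜ y) hmem
    have h₃ := perm_one_of_adjJ hp y h₂
    rw [h₁, Δ.δ_self, L.perm_simple, hp] at h₃
    simp at h₃
  refine (hthick p c).trans ?_
  rw [← hinj.encard_image]
  refine Set.encard_le_encard ?_
  rintro _ ⟨y, hy, rfl⟩
  have h1 : Δ.pos L y (Δ.residueOf {p}ᶜ y) = 1 := (pos_eq_one_iff hp).2 (Δ.mem_residueOf _ y)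
  refine (agree_of_adj (n := 2) (by lia) hy).pos_le hp (h1.le.trans one_le_two)

/-- A line in a flat of rank `n + 1` meets every flat of rank `n` in it. -/
theorem exists_mem_flat_two (hp : L.label p = 1) (hxy : x ≠ y) (hx : x ∈ Δ.flat L p c (n + 1))
    (hy : y ∈ Δ.flat L p c (n + 1)) (hx' : x ∈ Δ.flat L p d 2) (hy' : y ∈ Δ.flat L p d 2) :
    ∃ z ∈ Δ.flat L p d 2, z ∈ Δ.flat L p c n := by
  by_cases hxn : Δ.pos L c x = n + 1
  · obtain ⟨e, he, hex, hey, h⟩ := exists_flat_two_eq hp hxy hx hy hx' hy'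
    obtain ⟨f, hef, hf⟩ := Δ.exists_adj_δ_eq p c e
    have hz := Δ.mem_residueOf {p}ᶜ f
    have hδ : Δ.pos L c (Δ.residueOf {p}ᶜ f) = L.perm cs (Δ.δ c e) 2 := by
      rw [pos_eq hp c hz, hf, L.perm_mul_simple, hp, Equiv.swap_apply_left]
    refine ⟨Δ.residueOf {p}ᶜ f, ?_, ?_⟩
    · rw [h]
      refine (agree_of_adj (n := 2) (by lia) hef).pos_le hp ?_
      rw [(pos_eq_one_iff hp).2 hz]
      exact one_le_two
    · have h₁ := pos_eq hp c ((pos_eq_one_iff hp).1 hex)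
      have h₂ : L.perm cs (Δ.δ c e) 2 ≠ L.perm cs (Δ.δ c e) 1 :=
        (L.perm cs (Δ.δ c e)).injective.ne (by decide)
      have h₃ : 2 ≤ n + 1 := by
        rw [← hey]
        exact he.symm.pos_le hp hy
      have h₄ := (agree_iff.1 he 2).2 h₃
      rw [mem_flat, hδ]
      lia
  · exact ⟨x, hx', by rw [mem_flat] at hx ⊢; lia⟩

theorem veblen_young_flat (hp : L.label p = 1) {a b a' b' : Δ.Vertex p} (haa : a ≠ a')
    (hbb : b ≠ b') {l l' g g' : C}
    (hal : a ∈ Δ.flat L p l 2) (hbl : b ∈ Δ.flat L p l 2)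
    (hal' : a' ∈ Δ.flat L p l' 2) (hbl' : b' ∈ Δ.flat L p l' 2)
    (hag : a ∈ Δ.flat L p g 2) (hag' : a' ∈ Δ.flat L p g 2)
    (hbg : b ∈ Δ.flat L p g' 2) (hbg' : b' ∈ Δ.flat L p g' 2)
    (h : (Δ.flat L p l 2 ∩ Δ.flat L p l' 2).Nonempty) :
    (Δ.flat L p g 2 ∩ Δ.flat L p g' 2).Nonempty := by
  have h23 (c : C) : Δ.flat L p c 2 ⊆ Δ.flat L p c 3 := flat_mono (by lia)
  -- All four points lie in a common plane.
  obtain ⟨e, hae, hbe, hae', hbe'⟩ : ∃ e, a ∈ Δ.flat L p e 3 ∧ b ∈ Δ.flat L p e 3 ∧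
      a' ∈ Δ.flat L p e 3 ∧ b' ∈ Δ.flat L p e 3 := by
    by_cases hl' : Δ.flat L p l' 2 ⊆ Δ.flat L p l 2
    · exact ⟨l, h23 l hal, h23 l hbl, h23 l (hl' hal'), h23 l (hl' hbl')⟩
    · obtain ⟨y, hyl', hyl⟩ := Set.not_subset.1 hl'
      obtain ⟨z, hzl, hzl'⟩ := h
      have hy3 : 3 ≤ Δ.pos L l y := Nat.lt_of_not_le hyl
      obtain ⟨e, hey, he⟩ := exists_agree_pos_eq hp l y (by lia) hy3
      have hle : Δ.flat L p l 2 ⊆ Δ.flat L p e 3 := by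
        rw [(he 2 (by lia)).flat_eq hp]
        exact h23 e
      have hl'e : Δ.flat L p l' 2 ⊆ Δ.flat L p e 3 :=
        flat_two_subset hp (fun hzy : z = y => hyl (hzy ▸ hzl)) (hle hzl) hey.le hzl' hyl'
      exact ⟨e, hle hal, hle hbl, hl'e hal', hl'e hbl'⟩
  -- Two lines of a plane meet.
  obtain ⟨f, hf, -, -, hg'⟩ := exists_flat_two_eq hp hbb hbe hbe' hbg hbg'
  rw [hf.flat_eq hp] at hae hae'
  obtain ⟨z, hz, hz'⟩ := exists_mem_flat_two hp haa hae hae' hag hag'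
  exact ⟨z, hz, hg' ▸ hz'⟩

/-- The projective space of a thick building of type `A_κ`: its lines are the second members of the
flags of the chambers. If `κ = 1`, its only line is the set of all points. -/
def projectiveSpace (hthick : Δ.IsThick) [Nonempty C] (hp : L.label p = 1) :
    ProjectiveSpace (Δ.Vertex p) where
  lines := Set.range fun c => Δ.flat L p c 2
  existsUnique_line a b hab := by
    obtain ⟨c, hc⟩ := Δ.residue_nonempty a
    obtain ⟨d, -, ha, hb⟩ := exists_join hp hab (n := max (Δ.pos L c a) (Δ.pos L c b)) (c := c)
      (le_max_left _ _) (le_max_right _ _)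
    have ha : a ∈ Δ.flat L p d 2 := ha.le.trans one_le_two
    have hb : b ∈ Δ.flat L p d 2 := hb.le
    refine ⟨Δ.flat L p d 2, ⟨⟨d, rfl⟩, ha, hb⟩, ?_⟩
    rintro _ ⟨⟨e, rfl⟩, ha', hb'⟩
    exact flat_two_eq hp hab ha' hb' ha hb
  three_le_encard := by
    rintro _ ⟨c, rfl⟩
    exact three_le_encard_flat_two hthick hp c
  veblen_young := by
    rintro a b a' b' hnd _ ⟨l, rfl⟩ _ ⟨l', rfl⟩ _ ⟨g, rfl⟩ _ ⟨g', rfl⟩ h₁ h₂ h₃ h₄ h₅ h₆ h₇ h₈ h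
    simp only [List.nodup_cons, List.mem_cons, not_or] at hnd
    exact veblen_young_flat hp hnd.1.2.1 hnd.2.1.2.1 h₁ h₂ h₃ h₄ h₅ h₆ h₇ h₈ h

theorem flat_zero (c : C) : Δ.flat L p c 0 = ∅ := by
  refine Set.eq_empty_of_forall_notMem fun x hx => ?_
  have h₁ : Δ.pos L c x ≤ 0 := hx
  have h₂ := one_le_pos (c := c) (x := x) (L := L)
  lia

section Rank

variable (hthick : Δ.IsThick) [Nonempty C] (hp : L.label p = 1)

theorem isSubspace_flat (c : C) (n : ℕ) :
    (projectiveSpace hthick hp).IsSubspace (Δ.flat L p c n) := by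
  rintro a ha b hb hab _ ⟨d, rfl⟩ had hbd
  exact flat_two_subset hp hab ha hb had hbd

/-- A flat of rank `n + 1` is spanned by a flat of rank `n` in it and one further point. -/
theorem span_insert_flat (hx : Δ.pos L c x = n + 1) :
    (projectiveSpace hthick hp).span (insert x (Δ.flat L p c n)) = Δ.flat L p c (n + 1) := by
  refine (ProjectiveSpace.span_subset _ (isSubspace_flat hthick hp c _)
    (Set.insert_subset hx.le (flat_mono n.le_succ))).antisymm fun y hy => ?_
  have hsub := (projectiveSpace hthick hp).subset_span (insert x (Δ.flat L p c n))
  by_cases hxy : x = y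
  · exact hsub (hxy ▸ Set.mem_insert x _)
  obtain ⟨_, ⟨⟨d, rfl⟩, hxd, hyd⟩, -⟩ := (projectiveSpace hthick hp).existsUnique_line x y hxy
  -- The line through `x` and `y` meets the flat of rank `n` in a point `z`.
  obtain ⟨z, hzd, hzc⟩ := exists_mem_flat_two hp hxy hx.le hy hxd hyd
  refine (projectiveSpace hthick hp).isSubspace_span _ x (hsub (Set.mem_insert x _)) z
    (hsub (Set.mem_insert_of_mem x hzc)) ?_ _ ⟨d, rfl⟩ hxd hzd hyd
  rintro rfl
  have : Δ.pos L c x ≤ n := hzc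
  lia

theorem exists_span_eq_flat (hp : L.label p = 1) (c : C) (hn : (n : ℕ∞) ≤ κ + 1) :
    ∃ A, (projectiveSpace hthick hp).span A = Δ.flat L p c n ∧ A.encard ≤ n := by
  induction n with
  | zero =>
    refine ⟨∅, ?_, by simp⟩
    rw [← flat_zero (L := L) (p := p) c]
    exact ProjectiveSpace.span_eq_self _ (isSubspace_flat hthick hp c 0)
  | succ n ih =>
    obtain ⟨A, hA, hAn⟩ := ih (le_trans (by exact_mod_cast n.le_succ) hn)
    obtain ⟨x, hx⟩ := exists_pos_eq (Δ := Δ) (p := p) hp c (by lia : 1 ≤ n + 1) hn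
    refine ⟨insert x A, ?_, (Set.encard_insert_le A x).trans ?_⟩
    · rw [← ProjectiveSpace.span_insert_span, hA, span_insert_flat hthick hp hx]
    · rw [Nat.cast_add, Nat.cast_one]
      gcongr

/-- The span of finitely many points is a flat. -/
theorem span_eq_flat {A : Set (Δ.Vertex p)} (hA : A.Finite) :
    ∃ (c : C) (n : ℕ), (n : ℕ∞) ≤ κ + 1 ∧ n ≤ A.encard ∧
      (projectiveSpace hthick hp).span A = Δ.flat L p c n := by
  induction A, hA using Set.Finite.induction_on with
  | empty =>
    obtain ⟨c⟩ := ‹Nonempty C›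
    refine ⟨c, 0, by simp, by simp, ?_⟩
    rw [← flat_zero (L := L) (p := p) c]
    exact ProjectiveSpace.span_eq_self _ (isSubspace_flat hthick hp c 0)
  | @insert x A hxA _ ih =>
    obtain ⟨c, n, hn, hnA, hA⟩ := ih
    rw [← ProjectiveSpace.span_insert_span, hA, Set.encard_insert_of_notMem hxA]
    by_cases hx : x ∈ Δ.flat L p c n
    · refine ⟨c, n, hn, hnA.trans le_self_add, ?_⟩
      rw [Set.insert_eq_of_mem hx, ProjectiveSpace.span_eq_self _ (isSubspace_flat hthick hp c n)]
    · obtain ⟨d, hd, h⟩ := exists_agree_pos_eq hp c x (by lia : 1 ≤ n + 1) (Nat.lt_of_not_le hx)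
      refine ⟨d, n + 1, hd ▸ pos_le, ?_, ?_⟩
      · rw [Nat.cast_add, Nat.cast_one]
        gcongr
      · rw [(h n (.inl n.lt_succ_self)).flat_eq hp, span_insert_flat hthick hp hd]

theorem rank_flat (c : C) (hn : (n : ℕ∞) ≤ κ + 1) :
    (projectiveSpace hthick hp).rank (Δ.flat L p c n) = n := by
  refine le_antisymm ?_ (le_iInf₂ fun A hA => ?_)
  · obtain ⟨A, hA, hAn⟩ := exists_span_eq_flat hthick hp c hn
    exact (iInf₂_le A hA).trans hAn
  · rcases A.finite_or_infinite with hfin | hinf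
    · obtain ⟨d, m, hm, hmA, h⟩ := span_eq_flat hthick hp hfin
      refine le_trans ?_ hmA
      exact_mod_cast le_of_flat_subset hp hn hm (hA.symm.trans h).subset
    · simp [hinf.encard_eq]

theorem rank_univ : (projectiveSpace hthick hp).rank Set.univ = κ + 1 := by
  obtain ⟨c⟩ := ‹Nonempty C›
  induction κ using ENat.recTopCoe with
  | coe k =>
    rw [← flat_eq_univ (L := L) (c := c) (n := k + 1) (by simp), rank_flat hthick hp c (by simp)]
    simp
  | top =>
    rw [top_add, eq_top_iff]
    refine le_iInf₂ fun A hA => ?_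
    rcases A.finite_or_infinite with hfin | hinf
    · obtain ⟨d, m, -, -, h⟩ := span_eq_flat hthick hp hfin
      obtain ⟨x, hx⟩ := exists_pos_eq (Δ := Δ) (p := p) hp d (by lia : 1 ≤ m + 1) (by simp)
      have : x ∈ Δ.flat L p d m := (hA.symm.trans h).subset (Set.mem_univ x)
      rw [mem_flat] at this
      lia
    · rw [hinf.encard_eq]

theorem exists_eq_flat_of_rank_eq {X : Set (Δ.Vertex p)}
    (h : (projectiveSpace hthick hp).rank X = n) : ∃ c, X = Δ.flat L p c n := by
  obtain ⟨A, rfl, hA⟩ := ProjectiveSpace.exists_span_eq_of_rank_eq _ h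
  have hfin : A.Finite := Set.finite_of_encard_eq_coe hA
  obtain ⟨c, m, hm, -, hc⟩ := span_eq_flat hthick hp hfin
  rw [hc, rank_flat hthick hp c hm] at h
  exact ⟨c, by rw [hc, ENat.natCast_inj.1 h]⟩

end Rank

/-! ### The diagram geometry -/

theorem label_le_add_one (L : TypeALabelling M κ) (i : I) : (L.label i : ℕ∞) ≤ κ + 1 :=
  (L.label_le i).trans le_self_add

theorem shadow_eq_flat (hp : L.label p = 1) {i : I} {R : Δ.Vertex i} (hc : c ∈ R.1) :
    Δ.shadow p R = Δ.flat L p c (L.label i) := by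
  ext x
  constructor
  · rintro ⟨d, hdx, hdR⟩
    have h := Δ.adjJ_of_mem hc hdR
    rw [← L.ne_label] at h
    exact Agree.pos_le hp h (((pos_eq_one_iff hp).2 hdx).le.trans (L.one_le_label i))
  · intro hx
    obtain ⟨d, hd, h⟩ := exists_agree_pos_eq hp c x le_rfl one_le_pos
    refine ⟨d, (pos_eq_one_iff hp).1 hd, Δ.mem_of_adjJ hc ?_⟩
    rw [← L.ne_label]
    exact h _ (.inr hx)

theorem incident_of_shadow_subset (hp : L.label p = 1) {i j : I} {R : Δ.Vertex i} {T : Δ.Vertex j}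
    (h : Δ.shadow p R ⊆ Δ.shadow p T) : Δ.Incident R T := by
  obtain ⟨c, hc⟩ := Δ.residue_nonempty R
  obtain ⟨d, hd⟩ := Δ.residue_nonempty T
  rw [shadow_eq_flat hp hc, shadow_eq_flat hp hd] at h
  obtain ⟨e, hce, hde⟩ := exists_agree_of_flat_subset hp (label_le_add_one L i)
    (label_le_add_one L j) h
  rw [Agree, L.ne_label] at hce hde
  exact ⟨e, Δ.mem_of_adjJ hc hce, Δ.mem_of_adjJ hd hde⟩

theorem isProjectiveGeometry (hthick : Δ.IsThick) [Nonempty C] (hp : L.label p = 1) :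
    IsProjectiveGeometry Δ.toChamberSystem κ L.equiv p (projectiveSpace hthick hp) where
  label_point := hp
  rank_univ := rank_univ hthick hp
  lines_eq i hi := by
    rw [L.coe_equiv] at hi
    ext l
    constructor
    · rintro ⟨c, rfl⟩
      exact ⟨Δ.residueOf _ c, by rw [← hi]; exact shadow_eq_flat hp (Δ.mem_residueOf _ c)⟩
    · rintro ⟨R, rfl⟩
      obtain ⟨c, hc⟩ := Δ.residue_nonempty R
      exact ⟨c, by rw [← hi]; exact (shadow_eq_flat hp hc).symm⟩
  shadow_injective i R T h := by
    obtain ⟨e, heR, heT⟩ := incident_of_shadow_subset hp (show Δ.shadow p R ⊆ _ from h.subset)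
    exact Δ.residue_eq heR heT
  range_shadow i := by
    rw [L.coe_equiv]
    ext X
    constructor
    · rintro ⟨R, rfl⟩
      obtain ⟨c, hc⟩ := Δ.residue_nonempty R
      change _ ∧ _
      simp only [shadow_eq_flat hp hc]
      exact ⟨isSubspace_flat hthick hp c _, rank_flat hthick hp c (label_le_add_one L i)⟩
    · rintro ⟨-, hX⟩
      obtain ⟨c, rfl⟩ := exists_eq_flat_of_rank_eq hthick hp hX
      exact ⟨Δ.residueOf _ c, shadow_eq_flat hp (Δ.mem_residueOf _ c)⟩
  incident_iff i j R T := by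
    constructor
    · rintro ⟨e, heR, heT⟩
      rw [shadow_eq_flat hp heR, shadow_eq_flat hp heT]
      exact (le_total (L.label i) (L.label j)).imp flat_mono flat_mono
    · rintro (h | h)
      · exact incident_of_shadow_subset hp h
      · obtain ⟨e, heT, heR⟩ := incident_of_shadow_subset hp h
        exact ⟨e, heR, heT⟩

end Building

theorem mainTheorem6 {I W C : Type*} [Group W] {M : CoxeterMatrix I} {cs : CoxeterSystem M W}
    (Δ : Building cs C) (hthick : Δ.toChamberSystem.IsThick)
    (hirr : (coxeterDiagram M).Connected)
    (G : Subgroup Δ.toChamberSystem.Aut) (J : Set I)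
    (hG : IsTwoTransitive G (Δ.toChamberSystem.Residue J)) :
    ∃ (κ : ℕ∞) (e : I ≃ ANode κ), M.reindex e = typeA κ ∧
      ∃ (p : I) (S : ProjectiveSpace (Δ.toChamberSystem.Vertex p)),
        IsProjectiveGeometry Δ.toChamberSystem κ e p S ∧
        IsTwoTransitive G (Δ.toChamberSystem.Vertex p) := by
  obtain ⟨p, rfl⟩ := Δ.eq_compl_singleton_of_isTwoTransitive hG
  obtain ⟨κ, L, hp⟩ := CoxeterSystem.exists_typeALabelling hirr
    (Δ.weightRep_weight_some_of_isTwoTransitive hG)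
  obtain ⟨⟨R, -, -⟩, -⟩ := id hG
  have : Nonempty C := (Δ.residue_nonempty R).to_type
  exact ⟨κ, L.equiv, L.reindex_equiv, p, _, Building.isProjectiveGeometry hthick hp, hG⟩
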